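/- All graphs are finite, simple and undirected, and all logarithms are binary. A colouring $\psi$ of the vertices of a graph $G$ is \emph{nonrepetitive} if there is no path $v_1,v_2,\dots,v_{2t}$ ($t\ge 1$) in $G$ with $\psi(v_i)=\psi(v_{t+i})$ for all $i\in\{1,\dots,t\}$. A graph $G$ is \emph{nonrepetitively $k$-choosable} if for every assignment of a set $L(v)$ of at least $k$ colours to each vertex $v$ of $G$ there is a nonrepetitive colouring of $G$ in which each vertex $v$ receives a colour from $L(v)$. A \emph{subdivision} of a graph $H$ is a graph obtained from $H$ by replacing the edges of $H$ with internally disjoint paths, where the path replacing $vw$ has endpoints $v$ and $w$; the number of times $vw$ is subdivided is the number of internal vertices of this path. \textbf{Theorem.} Let $G$ be a subdivision of a graph $H$ such that each edge $vw\in E(H)$ is subdivided at least $$\lceil 10^{5}\log(\deg_H(v)+1)\rceil+\lceil 10^{5}\log(\deg_H(w)+1)\rceil+2$$ times in $G$. Then $G$ is nonrepetitively $5$-choosable, that is, its nonrepetitive choice number (the minimum integer $k$ such that $G$ is nonrepetitively $k$-choosable) is at most $5$. -/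

import Mathlib

universe u v w

namespace SimpleGraph

/-- The path `p`, with vertices `v₀, …, v_{2t-1}` in order, is repetitively coloured by `c`:
its number of vertices is even, `2 * t`, and `c vᵢ = c v_{t+i}` for all `i < t`.
(A walk has at least one vertex, so `t ≥ 1`.) -/
def Walk.IsRepetitivelyColoured {W : Type u} {C : Type w} {G : SimpleGraph W} {x y : W}
    (p : G.Walk x y) (c : W → C) : Prop :=
  ∃ t : ℕ, p.length + 1 = 2 * t ∧ ∀ i < t, c (p.getVert i) = c (p.getVert (t + i))

/-- A colouring is nonrepetitive if no path of the graph is repetitively coloured. -/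
def IsNonrepetitive {W : Type u} {C : Type w} (G : SimpleGraph W) (c : W → C) : Prop :=
  ∀ (x y : W) (p : G.Walk x y), p.IsPath → ¬ p.IsRepetitivelyColoured c

/-- `G` is nonrepetitively `k`-choosable: for every assignment of lists of at least `k` colours
to the vertices there is a nonrepetitive colouring taking each vertex's colour from its list. -/
def IsNonrepetitivelyChoosable {W : Type u} (G : SimpleGraph W) (k : ℕ) : Prop :=
  ∀ (C : Type w) (L : W → Set C), (∀ x, (k : ℕ∞) ≤ (L x).encard) →
    ∃ c : W → C, (∀ x, c x ∈ L x) ∧ G.IsNonrepetitive c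

/-- The data exhibiting `G` as a subdivision of `H`: the vertices of `H` are vertices of `G`
(through `branch`), and `G` arises from `H` by replacing every edge `vw` by a path from `v` to `w`,
these paths being internally disjoint from each other and from the vertices of `H`. -/
structure Subdivision {V : Type u} {W : Type v} (H : SimpleGraph V) (G : SimpleGraph W) where
  /-- the original vertices -/
  branch : V ↪ W
  /-- the path replacing an edge, traversed from the first named endpoint to the second -/
  path : ∀ {a b : V}, H.Adj a b → G.Walk (branch a) (branch b)
  isPath : ∀ {a b : V} (h : H.Adj a b), (path h).IsPath
  /-- an edge is replaced by one path, whichever endpoint is named first -/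
  path_symm : ∀ {a b : V} (h : H.Adj a b), path h.symm = (path h).reverse
  /-- inner vertices of the paths are not original vertices -/
  eq_or_eq_of_branch_mem : ∀ {a b : V} (h : H.Adj a b) (z : V),
    branch z ∈ (path h).support → z = a ∨ z = b
  /-- paths replacing different edges meet at most in original vertices -/
  internally_disjoint : ∀ {a b a' b' : V} (h : H.Adj a b) (h' : H.Adj a' b'),
    s(a, b) ≠ s(a', b') → ∀ x ∈ (path h).support, x ∈ (path h').support → x ∈ Set.range branch
  /-- there are no further vertices -/
  vertex_cover : ∀ x : W,
    x ∈ Set.range branch ∨ ∃ (a b : V) (h : H.Adj a b), x ∈ (path h).support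
  /-- there are no further edges -/
  edge_cover : ∀ x y : W, G.Adj x y → ∃ (a b : V) (h : H.Adj a b), s(x, y) ∈ (path h).edges

/-- The number of times an edge is subdivided: the number of inner vertices of its path
(the path has different endpoints, so its length is at least `1`). -/
def Subdivision.numDivisionVertices {V : Type u} {W : Type v} {H : SimpleGraph V}
    {G : SimpleGraph W} (S : H.Subdivision G) {a b : V} (h : H.Adj a b) : ℕ :=
  (S.path h).length - 1

end SimpleGraph

/-!
Let `B` be the set of original vertices (branch vertices) of the subdivision, and write `ρ v` for
the radius `⌈10 ^ 5 * log (deg v + 1)⌉`. The branch vertices are precoloured, and the colour of `v`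
is deleted from the lists of the inner vertices within distance `ρ v` of `v`. These neighbourhoods
are disjoint, so at least four colours remain at each inner vertex (`reducedList`,
`isSparse_reducedList`). The gain is that a repetitive path with `2 t` vertices through `v` has
`t > ρ v` (`IsSparse.radius_lt`), so that it is long enough to pay for the branching at `v`.

The precolouring is extended to the inner vertices by a counting argument. Let `C(T)` be the number
of nonrepetitive list colourings of the subgraph induced by `T`. The claim (`grows`) is that
`C(T) ≥ 2 C(T - x)` if `x ∈ T` is an inner vertex with at most one inner neighbour in `T`. It is
proved by induction on `|T|`. Among the at least `4 C(T - x)` extensions to `x` of the colourings of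
`T - x`, those that are repetitive on a given path through `x` with `2 t` vertices are determined
off the half `A` of the path that contains `x`. The inner vertices of `A` can be deleted one after
the other, from `x` outwards, and each has at most one inner neighbour left when its turn comes. So
by induction there are at most `2 ^ (1 - s) C(T - x)` such colourings, where `s` is the number of
inner vertices in `A` (`Grows.card_isRep_le`).

* There is at most one path for each `t` among those without branch vertices, as `x` is an end of
  it. The paths with `t ≥ 3` exclude at most `C(T - x) / 2` colourings in total. The estimates
  `C(T - x)` for `t = 1` and `C(T - x) / 2` for `t = 2` would then leave no room for the paths
  through branch vertices. But if the path
  `x, y, z, w, v` has `y` and `w` of equal colours, which is needed for `t = 2` to exclude a colour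
  at `x`, then `z` and `v` have different colours (`card_almostBad_add_le`), so that fewer colours
  were excluded when `y` was added. This saves a constant proportion of `C(T - x)`
  (`Grows.step`, `grows`).
* The number of paths through a branch vertex is at most the product of the degrees met, up to a
  factor linear in `t`. By the radius condition this product is at most `(1 + ε) ^ t`, so that these
  paths exclude at most `C(T - x) / 20` colourings (`Grows.card_badCross_le`).
-/

namespace NonrepSubdivision

open SimpleGraph Finset
open scoped Classical

/-! ### Paths and partial colourings -/

section Counting

variable {W : Type*} {C : Type*}

/-- The first `n` terms of `p` are the vertices, in order, of a path of `G`. -/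
def IsPathSeq (G : SimpleGraph W) (p : ℕ → W) (n : ℕ) : Prop :=
  (∀ i, i + 1 < n → G.Adj (p i) (p (i + 1))) ∧ ∀ i < n, ∀ j < n, p i = p j → i = j

/-- The first `2 * t` terms of `p` are repetitively coloured by `c`. -/
def IsRep (c : W → C) (p : ℕ → W) (t : ℕ) : Prop := ∀ i < t, c (p i) = c (p (t + i))

theorem IsPathSeq.mono {G : SimpleGraph W} {p : ℕ → W} {m n : ℕ} (hp : IsPathSeq G p n)
    (h : m ≤ n) : IsPathSeq G p m :=
  ⟨fun i hi => hp.1 i (by omega), fun i hi j hj => hp.2 i (by omega) j (by omega)⟩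

theorem IsPathSeq.shift {G : SimpleGraph W} {p : ℕ → W} {m n : ℕ} (k : ℕ)
    (hp : IsPathSeq G p n) (h : k + m ≤ n) : IsPathSeq G (fun i => p (k + i)) m :=
  ⟨fun i hi => hp.1 (k + i) (by omega), fun i hi j hj e => by
    have := hp.2 (k + i) (by omega) (k + j) (by omega) e
    omega⟩

theorem IsPathSeq.reverse {G : SimpleGraph W} {p : ℕ → W} {m n k : ℕ}
    (hp : IsPathSeq G p n) (hk : k < n) (h : m ≤ k + 1) : IsPathSeq G (fun i => p (k - i)) m := by
  refine ⟨fun i hi => ?_, fun i hi j hj e => ?_⟩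
  · have := hp.1 (k - (i + 1)) (by omega)
    rw [show k - (i + 1) + 1 = k - i by omega] at this
    exact this.symm
  · have := hp.2 (k - i) (by omega) (k - j) (by omega) e
    omega

theorem IsRep.reverse {c : W → C} {p : ℕ → W} {t : ℕ} (h : IsRep c p t) :
    IsRep c (fun i => p (2 * t - 1 - i)) t := by
  intro i hi
  have := h (t - 1 - i) (by omega)
  rw [show t + (t - 1 - i) = 2 * t - 1 - i by omega] at this
  simp only
  rw [show 2 * t - 1 - (t + i) = t - 1 - i by omega]
  exact this.symm

/-- A graph `G` with list assignment `L`, whose vertices outside the set `B` of branch vertices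
have degree at most two and lists of at least four colours, and where every path leaving a branch
vertex `b` meets no other branch vertex, and no vertex with a colour in common with `b`, during its
first `r b` steps. The radius `r b` is at least a large multiple of the logarithm of the degree
of `b` plus one. -/
structure IsSparse [Fintype W] (G : SimpleGraph W) (B : Finset W) (L : W → Finset C) (r : W → ℕ) :
    Prop where
  deg_le_two : ∀ x ∉ B, ∀ y₁ y₂ y₃, G.Adj x y₁ → G.Adj x y₂ → G.Adj x y₃ →
    y₁ = y₂ ∨ y₁ = y₃ ∨ y₂ = y₃
  /-- the graph without its branch vertices is a forest -/
  exists_end : ∀ S : Finset W, S.Nonempty → (∀ x ∈ S, x ∉ B) →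
    ∃ x ∈ S, ∀ y ∈ S, ∀ z ∈ S, G.Adj x y → G.Adj x z → y = z
  four_le : ∀ x ∉ B, 4 ≤ (L x).card
  nonempty : ∀ x, (L x).Nonempty
  le_radius : ∀ b ∈ B, 40 ≤ r b
  degree_le : ∀ b ∈ B, 2 * ((G.neighborFinset b).card + 1 : ℝ) ≤ (1001 / 1000) ^ (r b)
  ball : ∀ p n, IsPathSeq G p (n + 1) → p 0 ∈ B → n ≤ r (p 0) → ∀ i, 0 < i → i ≤ n →
    p i ∉ B ∧ Disjoint (L (p 0)) (L (p i))

/-- `c` has no repetitively coloured path inside `T`. -/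
def NonrepOn (G : SimpleGraph W) (T : Finset W) (c : W → C) : Prop :=
  ∀ t p, 0 < t → IsPathSeq G p (2 * t) → (∀ i < 2 * t, p i ∈ T) → ¬ IsRep c p t

/-- The colouring that agrees with `c` on `T` and takes the default colours `d` elsewhere. -/
noncomputable def restr (d : W → C) (T : Finset W) (c : W → C) : W → C :=
  fun x => if x ∈ T then c x else d x

/-- The list colourings of `T`, extended by the default colours `d` outside `T`. -/
noncomputable def listCol [Fintype W] (L : W → Finset C) (d : W → C) (T : Finset W) :
    Finset (W → C) :=
  Fintype.piFinset fun x => if x ∈ T then L x else {d x}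

/-- The nonrepetitive list colourings of the subgraph induced by `T`, extended by the default
colours `d` outside `T`. -/
noncomputable def col [Fintype W] (G : SimpleGraph W) (L : W → Finset C) (d : W → C)
    (T : Finset W) : Finset (W → C) :=
  (listCol L d T).filter (NonrepOn G T)

theorem mem_listCol [Fintype W] {L : W → Finset C} {d : W → C} {T : Finset W} {c : W → C} :
    c ∈ listCol L d T ↔ (∀ x ∈ T, c x ∈ L x) ∧ ∀ x ∉ T, c x = d x := by
  simp only [listCol, Fintype.mem_piFinset]
  constructor
  · intro h
    exact ⟨fun x hx => by simpa [hx] using h x, fun x hx => by simpa [hx] using h x⟩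
  · rintro ⟨h1, h2⟩ x
    by_cases hx : x ∈ T
    · simpa [hx] using h1 x hx
    · simpa [hx] using h2 x hx

theorem mem_col [Fintype W] {G : SimpleGraph W} {L : W → Finset C} {d : W → C} {T : Finset W}
    {c : W → C} :
    c ∈ col G L d T ↔ ((∀ x ∈ T, c x ∈ L x) ∧ ∀ x ∉ T, c x = d x) ∧ NonrepOn G T c := by
  rw [col, Finset.mem_filter, mem_listCol]

theorem restr_of_mem {d : W → C} {T : Finset W} {c : W → C} {x : W} (h : x ∈ T) :
    restr d T c x = c x := if_pos h

theorem restr_of_notMem {d : W → C} {T : Finset W} {c : W → C} {x : W} (h : x ∉ T) :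
    restr d T c x = d x := if_neg h

theorem restr_restr {d : W → C} {S T : Finset W} (h : S ⊆ T) (c : W → C) :
    restr d S (restr d T c) = restr d S c := by
  funext x
  by_cases hx : x ∈ S
  · rw [restr_of_mem hx, restr_of_mem hx, restr_of_mem (h hx)]
  · rw [restr_of_notMem hx, restr_of_notMem hx]

theorem NonrepOn.congr {G : SimpleGraph W} {T : Finset W} {c c' : W → C} (h : NonrepOn G T c)
    (e : ∀ x ∈ T, c' x = c x) : NonrepOn G T c' := by
  intro t p ht hp hT hrep
  refine h t p ht hp hT fun i hi => ?_
  rw [← e _ (hT i (by omega)), ← e _ (hT (t + i) (by omega)), hrep i hi]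

theorem NonrepOn.mono {G : SimpleGraph W} {S T : Finset W} {c : W → C} (h : NonrepOn G T c)
    (hST : S ⊆ T) : NonrepOn G S c :=
  fun t p ht hp hS => h t p ht hp fun i hi => hST (hS i hi)

theorem restr_mem_col [Fintype W] {G : SimpleGraph W} {L : W → Finset C} {d : W → C}
    {S T : Finset W} (hST : S ⊆ T) {c : W → C} (hc : c ∈ col G L d T) :
    restr d S c ∈ col G L d S := by
  rw [mem_col] at hc ⊢
  refine ⟨⟨fun x hx => ?_, fun x hx => restr_of_notMem hx⟩, ?_⟩
  · rw [restr_of_mem hx]; exact hc.1.1 x (hST hx)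
  · exact (hc.2.mono hST).congr fun x hx => restr_of_mem hx

/-- The list colourings of `T` that are nonrepetitive on `T` without `x`. -/
noncomputable def extCol [Fintype W] (G : SimpleGraph W) (L : W → Finset C) (d : W → C)
    (T : Finset W) (x : W) : Finset (W → C) :=
  (listCol L d T).filter fun c => restr d (T.erase x) c ∈ col G L d (T.erase x)

theorem mem_extCol [Fintype W] {G : SimpleGraph W} {L : W → Finset C} {d : W → C}
    {T : Finset W} {x : W} {c : W → C} : c ∈ extCol G L d T x ↔
      ((∀ x ∈ T, c x ∈ L x) ∧ ∀ x ∉ T, c x = d x) ∧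
        restr d (T.erase x) c ∈ col G L d (T.erase x) := by
  rw [extCol, Finset.mem_filter, mem_listCol]

theorem card_mul_le_card_extCol [Fintype W] {G : SimpleGraph W} {L : W → Finset C} {d : W → C}
    {T : Finset W} {x : W} (hx : x ∈ T) :
    (L x).card * (col G L d (T.erase x)).card ≤ (extCol G L d T x).card := by
  rw [← Finset.card_product]
  refine Finset.card_le_card_of_injOn (fun q => Function.update q.2 x q.1) ?_ ?_
  · rintro ⟨a, c⟩ hq
    simp only [Finset.coe_product, Set.mem_prod, Finset.mem_coe] at hq
    obtain ⟨ha, hc⟩ := hq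
    have hre : restr d (T.erase x) (Function.update c x a) = c := by
      funext y
      by_cases hy : y ∈ T.erase x
      · rw [restr_of_mem hy, Function.update_of_ne (Finset.ne_of_mem_erase hy)]
      · rw [restr_of_notMem hy, (mem_col.1 hc).1.2 y hy]
    rw [Finset.mem_coe, mem_extCol]
    simp only
    rw [hre]
    refine ⟨⟨fun y hy => ?_, fun y hy => ?_⟩, hc⟩
    · by_cases e : y = x
      · subst e; simpa using ha
      · rw [Function.update_of_ne e]
        exact (mem_col.1 hc).1.1 y (Finset.mem_erase.2 ⟨e, hy⟩)
    · have e : y ≠ x := fun e => hy (e ▸ hx)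
      rw [Function.update_of_ne e]
      exact (mem_col.1 hc).1.2 y fun h => hy (Finset.mem_of_mem_erase h)
  · rintro ⟨a, c⟩ hq ⟨a', c'⟩ hq' e
    simp only [Finset.coe_product, Set.mem_prod, Finset.mem_coe] at hq hq'
    simp only at e
    have e1 : a = a' := by simpa using congrFun e x
    have e2 : c = c' := by
      funext y
      by_cases hy : y = x
      · subst hy
        rw [(mem_col.1 hq.2).1.2 y (by simp), (mem_col.1 hq'.2).1.2 y (by simp)]
      · simpa [hy] using congrFun e y
    rw [e1, e2]

/-! ### Deleting the ends of paths -/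

/-- `x` is an end of the forest induced by the non-branch vertices of `T`. -/
def IsEnd (G : SimpleGraph W) (B T : Finset W) (x : W) : Prop :=
  x ∈ T ∧ x ∉ B ∧ ∀ y ∈ T, y ∉ B → ∀ z ∈ T, z ∉ B → G.Adj x y → G.Adj x z → y = z

/-- Deleting an end at least halves the number of colourings, for sets of fewer than `N`
vertices. -/
def Grows [Fintype W] (G : SimpleGraph W) (B : Finset W) (L : W → Finset C) (d : W → C)
    (N : ℕ) : Prop :=
  ∀ T x, T.card < N → IsEnd G B T x → 2 * (col G L d (T.erase x)).card ≤ (col G L d T).card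

/-- The factor by which a vertex of a deleted half-path weakens the bound `2 ^ (1 - t)`: branch
vertices are not deleted, so the factor `2` is not gained there. -/
noncomputable def branchTwo (B : Finset W) (v : W) : ℕ := if v ∈ B then 2 else 1

theorem one_le_branchTwo (B : Finset W) (v : W) : 1 ≤ branchTwo B v := by
  unfold branchTwo; split_ifs <;> norm_num

variable [Fintype W] {G : SimpleGraph W} {B : Finset W} {L : W → Finset C} {r : W → ℕ}
  {d : W → C}

/-- The non-branch vertices of a path can be deleted one after the other, starting next to
a vertex that is absent: each of them is an end when its turn comes. -/
theorem Grows.peel (hS : IsSparse G B L r) {N : ℕ} (hN : Grows G B L d N) {T : Finset W}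
    (hT : T.card < N) {p : ℕ → W} {n : ℕ} (hp : IsPathSeq G p (n + 1)) (h0 : p 0 ∉ T)
    (hpT : ∀ i, 0 < i → i ≤ n → p i ∈ T) :
    (col G L d (T.filter fun v => v ∈ B ∨ ∀ i, 0 < i → i ≤ n → v ≠ p i)).card * 2 ^ n ≤
      (col G L d T).card * ∏ i ∈ range n, branchTwo B (p (i + 1)) := by
  induction n with
  | zero =>
    have : (T.filter fun v => v ∈ B ∨ ∀ i, 0 < i → i ≤ 0 → v ≠ p i) = T := by
      apply Finset.filter_true_of_mem
      intro v _
      right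
      intro i h1 h2
      omega
    rw [this]
    simp
  | succ n ih =>
    have ih' := ih (hp.mono (by omega)) fun i h1 h2 => hpT i h1 (by omega)
    set R := T.filter fun v => v ∈ B ∨ ∀ i, 0 < i → i ≤ n → v ≠ p i with hR
    set R' := T.filter fun v => v ∈ B ∨ ∀ i, 0 < i → i ≤ n + 1 → v ≠ p i with hR'
    rw [Finset.prod_range_succ, pow_succ]
    by_cases hb : p (n + 1) ∈ B
    · have : R' = R := by
        apply Finset.filter_congr
        intro v _
        constructor
        · rintro (h | h)
          · exact Or.inl h
          · exact Or.inr fun i h1 h2 => h i h1 (by omega)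
        · rintro (h | h)
          · exact Or.inl h
          · by_cases hv : v ∈ B
            · exact Or.inl hv
            · refine Or.inr fun i h1 h2 e => ?_
              rcases Nat.lt_or_ge n i with h3 | h3
              · obtain rfl : i = n + 1 := by omega
                exact hv (e ▸ hb)
              · exact h i h1 h3 e
      rw [this, branchTwo, if_pos hb]
      nlinarith
    · have hmem : p (n + 1) ∈ R := by
        rw [hR, Finset.mem_filter]
        refine ⟨hpT _ (by omega) le_rfl, Or.inr fun i h1 h2 e => ?_⟩
        have := hp.2 (n + 1) (by omega) i (by omega) e
        omega
      have hErase : R' = R.erase (p (n + 1)) := by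
        ext v
        simp only [hR, hR', Finset.mem_filter, Finset.mem_erase]
        constructor
        · rintro ⟨h1, h2⟩
          rcases h2 with h2 | h2
          · exact ⟨fun e => hb (e ▸ h2), h1, Or.inl h2⟩
          · exact ⟨h2 _ (by omega) le_rfl, h1, Or.inr fun i h3 h4 => h2 i h3 (by omega)⟩
        · rintro ⟨h1, h2, h3⟩
          refine ⟨h2, h3.imp_right fun h3 i h4 h5 => ?_⟩
          rcases Nat.lt_or_ge n i with h6 | h6
          · obtain rfl : i = n + 1 := by omega
            exact h1
          · exact h3 i h4 h6
      have hadj : G.Adj (p (n + 1)) (p n) := (hp.1 n (by omega)).symm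
      -- the preceding vertex of the path is no longer present, or is a branch vertex
      have hgone : ∀ y ∈ R, y ∉ B → y ≠ p n := by
        intro y hy hyB e
        rw [hR, Finset.mem_filter] at hy
        rcases Nat.eq_zero_or_pos n with h | h
        · subst h
          exact h0 (e ▸ hy.1)
        · exact (hy.2.resolve_left hyB) n h le_rfl e
      have hend : IsEnd G B R (p (n + 1)) := by
        refine ⟨hmem, hb, fun y hy hyB z hz hzB h1 h2 => ?_⟩
        rcases hS.deg_le_two _ hb _ _ _ h1 h2 hadj with h | h | h
        · exact h
        · exact absurd h (hgone y hy hyB)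
        · exact absurd h (hgone z hz hzB)
      have := hN R _ (lt_of_le_of_lt (Finset.card_le_card (Finset.filter_subset _ _)) hT) hend
      rw [hErase, branchTwo, if_neg hb, mul_one]
      refine le_trans ?_ ih'
      rw [mul_comm (2 ^ n), ← mul_assoc, mul_comm _ 2]
      exact Nat.mul_le_mul_right _ this

/-- The bound on the number of colourings that become repetitive on a given path when `x` is
coloured: the colours of the half of the path containing `x` are determined by the rest. -/
theorem Grows.card_isRep_le (hS : IsSparse G B L r) {T : Finset W}
    (hN : Grows G B L d T.card) {p : ℕ → W} {t j : ℕ} (hp : IsPathSeq G p (2 * t))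
    (hpT : ∀ i < 2 * t, p i ∈ T) (hj : j < 2 * t) (hjB : p j ∉ B) :
    ((extCol G L d T (p j)).filter fun c => IsRep c p t).card * 2 ^ t ≤
      2 * (col G L d (T.erase (p j))).card * ((∏ i ∈ range j, branchTwo B (p (j - (i + 1)))) *
        ∏ i ∈ range (2 * t - 1 - j), branchTwo B (p (j + (i + 1)))) := by
  -- the half of the path that contains `p j` has the indices from `a` to `a + t - 1`
  obtain ⟨a, ha1, ha2, ha3⟩ : ∃ a, (a = 0 ∨ a = t) ∧ a ≤ j ∧ j < a + t := by
    rcases Nat.lt_or_ge j t with h | h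
    · exact ⟨0, Or.inl rfl, by omega, by omega⟩
    · exact ⟨t, Or.inr rfl, by omega, by omega⟩
  set x := p j with hx
  have hxT : x ∈ T := hpT j hj
  have hcard : (T.erase x).card < T.card := Finset.card_erase_lt_of_mem hxT
  set n₁ := j - a with hn₁
  set n₂ := a + t - 1 - j with hn₂
  have h1 := hN.peel hS hcard (p := fun i => p (j - i)) (n := n₁)
    (hp.reverse hj (by omega)) (by simp [hx]) (fun i hi hi' => by
      refine Finset.mem_erase.2 ⟨fun e => ?_, hpT _ (by omega)⟩
      have := hp.2 _ (by omega) _ hj e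
      omega)
  set R := (T.erase x).filter fun v => v ∈ B ∨ ∀ i, 0 < i → i ≤ n₁ → v ≠ p (j - i) with hR
  have h2 := hN.peel hS (T := R)
    (lt_of_le_of_lt (Finset.card_le_card (Finset.filter_subset _ _)) hcard)
    (p := fun i => p (j + i)) (n := n₂)
    (hp.shift j (by omega)) (by simp [hR, hx]) (fun i hi hi' => by
      rw [hR, Finset.mem_filter]
      refine ⟨Finset.mem_erase.2 ⟨fun e => ?_, hpT _ (by omega)⟩, Or.inr fun k hk hk' e => ?_⟩
      · have := hp.2 _ (by omega) _ hj e
        omega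
      · have := hp.2 _ (by omega) _ (by omega) e
        omega)
  set R' := R.filter fun v => v ∈ B ∨ ∀ i, 0 < i → i ≤ n₂ → v ≠ p (j + i) with hR'
  have hsub : R' ⊆ T.erase x := (Finset.filter_subset _ _).trans (Finset.filter_subset _ _)
  -- a vertex of `T` outside `R'` is in the half of `p j`
  have hout : ∀ v ∈ T, v ∉ R' → v ∉ B ∧ ∃ i, a ≤ i ∧ i < a + t ∧ v = p i := by
    intro v hv hv'
    simp only [hR', hR, Finset.mem_filter, Finset.mem_erase, not_and, not_or] at hv'
    by_cases e : v = x
    · exact ⟨e ▸ hjB, j, ha2, ha3, e⟩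
    · have hvB : v ∉ B := by
        intro hB
        exact (hv' ⟨⟨e, hv⟩, Or.inl hB⟩).1 hB
      refine ⟨hvB, ?_⟩
      by_cases h : ∀ i, 0 < i → i ≤ n₁ → v ≠ p (j - i)
      · have := (hv' ⟨⟨e, hv⟩, Or.inr h⟩).2
        push Not at this
        obtain ⟨i, hi1, hi2, hi3⟩ := this
        exact ⟨j + i, by omega, by omega, hi3⟩
      · push Not at h
        obtain ⟨i, hi1, hi2, hi3⟩ := h
        exact ⟨j - i, by omega, by omega, hi3⟩
  have hin : ∀ i < 2 * t, ¬ (a ≤ i ∧ i < a + t) → p i ∈ R' := by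
    intro i hi hia
    simp only [hR', hR, Finset.mem_filter, Finset.mem_erase]
    refine ⟨⟨⟨fun e => ?_, hpT i hi⟩, Or.inr fun k hk hk' e => ?_⟩, Or.inr fun k hk hk' e => ?_⟩
    · have := hp.2 _ hi _ hj e
      omega
    · have := hp.2 _ hi _ (by omega) e
      omega
    · have := hp.2 _ hi _ (by omega) e
      omega
  have h3 : ((extCol G L d T x).filter fun c => IsRep c p t).card ≤ (col G L d R').card := by
    refine Finset.card_le_card_of_injOn (restr d R') ?_ ?_
    · intro c hc
      rw [Finset.mem_coe, Finset.mem_filter, mem_extCol] at hc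
      rw [Finset.mem_coe, ← restr_restr hsub]
      exact restr_mem_col hsub hc.1.2
    · intro c hc c' hc' e
      rw [Finset.mem_coe, Finset.mem_filter, mem_extCol] at hc hc'
      have hagree : ∀ v ∈ R', c v = c' v := by
        intro v hv
        have := congrFun e v
        rwa [restr_of_mem hv, restr_of_mem hv] at this
      funext v
      by_cases hvT : v ∈ T
      · by_cases hvR : v ∈ R'
        · exact hagree v hvR
        · obtain ⟨-, i, hi1, hi2, rfl⟩ := hout v hvT hvR
          rcases ha1 with h | h
          · rw [hc.2 i (by omega), hc'.2 i (by omega)]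
            exact hagree _ (hin _ (by omega) (by omega))
          · have e1 := hc.2 (i - t) (by omega)
            have e2 := hc'.2 (i - t) (by omega)
            rw [show t + (i - t) = i by omega] at e1 e2
            rw [← e1, ← e2]
            exact hagree _ (hin _ (by omega) (by omega))
      · rw [hc.1.1.2 v hvT, hc'.1.1.2 v hvT]
  have h4 : ∏ i ∈ range n₁, branchTwo B (p (j - (i + 1))) ≤
      ∏ i ∈ range j, branchTwo B (p (j - (i + 1))) :=
    Finset.prod_le_prod_of_subset_of_one_le' (by simp; omega) fun _ _ _ => one_le_branchTwo _ _
  have h5 : ∏ i ∈ range n₂, branchTwo B (p (j + (i + 1))) ≤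
      ∏ i ∈ range (2 * t - 1 - j), branchTwo B (p (j + (i + 1))) :=
    Finset.prod_le_prod_of_subset_of_one_le' (by simp; omega) fun _ _ _ => one_le_branchTwo _ _
  calc _ ≤ (col G L d R').card * 2 ^ t := Nat.mul_le_mul_right _ h3
    _ = 2 * ((col G L d R').card * 2 ^ n₂) * 2 ^ n₁ := by
        rw [show t = n₂ + n₁ + 1 by omega]; ring
    _ ≤ 2 * ((col G L d R).card * ∏ i ∈ range n₂, branchTwo B (p (j + (i + 1)))) * 2 ^ n₁ := by
        gcongr
    _ = 2 * ((col G L d R).card * 2 ^ n₁) * ∏ i ∈ range n₂, branchTwo B (p (j + (i + 1))) := by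
        ring
    _ ≤ 2 * ((col G L d (T.erase x)).card * ∏ i ∈ range n₁, branchTwo B (p (j - (i + 1)))) *
          ∏ i ∈ range n₂, branchTwo B (p (j + (i + 1))) := by gcongr
    _ ≤ 2 * ((col G L d (T.erase x)).card * ∏ i ∈ range j, branchTwo B (p (j - (i + 1)))) *
          ∏ i ∈ range (2 * t - 1 - j), branchTwo B (p (j + (i + 1))) := by gcongr
    _ = _ := by ring

/-! ### Paths without branch vertices -/

/-- The first `n` terms of `p` form a path from `x` in `T` without branch vertices. -/
def IsInner (G : SimpleGraph W) (B T : Finset W) (x : W) (p : ℕ → W) (n : ℕ) : Prop :=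
  IsPathSeq G p n ∧ p 0 = x ∧ ∀ i < n, p i ∈ T ∧ p i ∉ B

/-- Inner vertices have degree at most two, so a path that starts at an end is determined by its
length. -/
theorem IsInner.eq (hS : IsSparse G B L r) {T : Finset W} {x : W} (hx : IsEnd G B T x)
    {p q : ℕ → W} {n : ℕ} (hp : IsInner G B T x p n) (hq : IsInner G B T x q n) :
    ∀ i < n, p i = q i := by
  intro i
  induction i using Nat.strong_induction_on with
  | _ i ih =>
    intro hi
    match i, ih, hi with
    | 0, _, _ => rw [hp.2.1, hq.2.1]
    | 1, _, hi =>
      have h1 := hp.1.1 0 hi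
      have h2 := hq.1.1 0 hi
      rw [hp.2.1] at h1
      rw [hq.2.1] at h2
      exact hx.2.2 _ (hp.2.2 1 hi).1 (hp.2.2 1 hi).2 _ (hq.2.2 1 hi).1 (hq.2.2 1 hi).2 h1 h2
    | i + 2, ih, hi =>
      have e0 := ih i (by omega) (by omega)
      have e1 := ih (i + 1) (by omega) (by omega)
      have h1 := hp.1.1 (i + 1) (by omega)
      have h2 := hq.1.1 (i + 1) (by omega)
      have h3 := (hp.1.1 i (by omega)).symm
      rw [← e1] at h2
      rcases hS.deg_le_two _ (hp.2.2 (i + 1) (by omega)).2 _ _ _ h1 h2 h3 with h | h | h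
      · exact h
      · have := hp.1.2 (i + 1 + 1) (by omega) i (by omega) h
        omega
      · rw [e0] at h
        have := hq.1.2 (i + 1 + 1) (by omega) i (by omega) h
        omega

/-- The colourings of `T` that are repetitive on the path of `2 * t` non-branch vertices starting
at `x`. -/
noncomputable def badInner (G : SimpleGraph W) (B : Finset W) (L : W → Finset C) (d : W → C)
    (T : Finset W) (x : W) (t : ℕ) : Finset (W → C) :=
  (extCol G L d T x).filter fun c => ∃ p, IsInner G B T x p (2 * t) ∧ IsRep c p t

theorem Grows.card_badInner_le (hS : IsSparse G B L r) {T : Finset W} {x : W}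
    (hN : Grows G B L d T.card) (hx : IsEnd G B T x) {t : ℕ} (ht : 0 < t) :
    (badInner G B L d T x t).card * 2 ^ t ≤ 2 * (col G L d (T.erase x)).card := by
  rcases (badInner G B L d T x t).eq_empty_or_nonempty with h | ⟨c₀, hc₀⟩
  · simp [h]
  · obtain ⟨-, p, hp, -⟩ := Finset.mem_filter.1 hc₀
    have key := hN.card_isRep_le hS hp.1 (fun i hi => (hp.2.2 i hi).1) (j := 0) (by omega)
      (hp.2.2 0 (by omega)).2
    have hprod : ∏ i ∈ range (2 * t - 1 - 0), branchTwo B (p (0 + (i + 1))) = 1 := by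
      refine Finset.prod_eq_one fun i hi => ?_
      rw [Finset.mem_range] at hi
      exact if_neg (hp.2.2 _ (by omega)).2
    rw [hprod, Finset.prod_range_zero, mul_one, mul_one, hp.2.1] at key
    refine le_trans (Nat.mul_le_mul_right _ (Finset.card_le_card ?_)) key
    intro c hc
    rw [badInner, Finset.mem_filter] at hc
    obtain ⟨hc, q, hq, hrep⟩ := hc
    have e := hp.eq hS hx hq
    refine Finset.mem_filter.2 ⟨hc, fun i hi => ?_⟩
    rw [e i (by omega), e (t + i) (by omega)]
    exact hrep i hi

/-- The colourings of `T` without the end `x` for which the path `x, y, z, w` from `x` has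
`y` and `w` of the same colour, so that a further colour is excluded at `x`. -/
noncomputable def almostBad (G : SimpleGraph W) (B : Finset W) (L : W → Finset C) (d : W → C)
    (T : Finset W) (x : W) : Finset (W → C) :=
  (col G L d (T.erase x)).filter fun c => ∃ p, IsInner G B T x p 4 ∧ c (p 1) = c (p 3)

theorem card_badInner_two_le (hS : IsSparse G B L r) {T : Finset W} {x : W}
    (hx : IsEnd G B T x) :
    (badInner G B L d T x 2).card ≤ (almostBad G B L d T x).card := by
  refine Finset.card_le_card_of_injOn (restr d (T.erase x)) ?_ ?_
  · intro c hc
    rw [Finset.mem_coe, badInner, Finset.mem_filter, mem_extCol] at hc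
    obtain ⟨hc, p, hp, hrep⟩ := hc
    rw [Finset.mem_coe, almostBad, Finset.mem_filter]
    refine ⟨hc.2, p, hp, ?_⟩
    have hne : ∀ i, 0 < i → i < 4 → p i ∈ T.erase x := by
      intro i h1 h2
      refine Finset.mem_erase.2 ⟨fun e => ?_, (hp.2.2 i h2).1⟩
      rw [← hp.2.1] at e
      have := hp.1.2 i h2 0 (by omega) e
      omega
    rw [restr_of_mem (hne 1 (by omega) (by omega)), restr_of_mem (hne 3 (by omega) (by omega))]
    exact hrep 1 (by omega)
  · intro c hc c' hc' e
    rw [Finset.mem_coe, badInner, Finset.mem_filter, mem_extCol] at hc hc'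
    obtain ⟨hc, p, hp, hrep⟩ := hc
    obtain ⟨hc', q, hq, hrep'⟩ := hc'
    have hpq := hp.eq hS hx hq
    have hagree : ∀ v ∈ T.erase x, c v = c' v := by
      intro v hv
      have := congrFun e v
      rwa [restr_of_mem hv, restr_of_mem hv] at this
    funext v
    by_cases hv : v ∈ T
    · by_cases hvx : v = x
      · have h1 := hrep 0 (by omega)
        have h2 := hrep' 0 (by omega)
        rw [← hpq 0 (by omega), ← hpq _ (by omega)] at h2
        have h0 : p 0 = v := by rw [hp.2.1, hvx]
        rw [h0] at h1 h2
        rw [h1, h2]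
        refine hagree _ (Finset.mem_erase.2 ⟨fun e => ?_, (hp.2.2 _ (by omega)).1⟩)
        rw [← hp.2.1] at e
        have := hp.1.2 _ (by omega) 0 (by omega) e
        omega
      · exact hagree v (Finset.mem_erase.2 ⟨hvx, hv⟩)
    · rw [hc.1.2 v hv, hc'.1.2 v hv]

/-- If `y` and `w` have the same colour on the path `x, y, z, w, v` then `z` and `v` have not,
since the colouring is nonrepetitive on `y, z, w, v`. -/
theorem card_almostBad_add_le (hS : IsSparse G B L r) {T : Finset W} {x : W}
    (hx : IsEnd G B T x) {p : ℕ → W} (hp : IsInner G B T x p 4) :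
    IsEnd G B (T.erase x) (p 1) ∧
    (almostBad G B L d T x).card + (almostBad G B L d (T.erase x) (p 1)).card ≤
      (col G L d ((T.erase x).erase (p 1))).card := by
  have hne : ∀ i, 0 < i → i < 4 → p i ∈ T.erase x := by
    intro i h1 h2
    refine Finset.mem_erase.2 ⟨fun e => ?_, (hp.2.2 i h2).1⟩
    rw [← hp.2.1] at e
    have := hp.1.2 i h2 0 (by omega) e
    omega
  have h01 := hp.1.1 0 (by omega)
  have hend : IsEnd G B (T.erase x) (p 1) := by
    refine ⟨hne 1 (by omega) (by omega), (hp.2.2 1 (by omega)).2, ?_⟩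
    intro y hy hyB z hz hzB h1 h2
    rw [hp.2.1] at h01
    rcases hS.deg_le_two _ (hp.2.2 1 (by omega)).2 _ _ _ h1 h2 h01.symm with h | h | h
    · exact h
    · exact absurd h (Finset.ne_of_mem_erase hy)
    · exact absurd h (Finset.ne_of_mem_erase hz)
  refine ⟨hend, ?_⟩
  have hp' : IsInner G B (T.erase x) (p 1) (fun i => p (1 + i)) 3 :=
    ⟨hp.1.shift 1 (by omega), rfl, fun i hi =>
      ⟨hne _ (by omega) (by omega), (hp.2.2 _ (by omega)).2⟩⟩
  have hsub : (T.erase x).erase (p 1) ⊆ T.erase x := Finset.erase_subset _ _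
  set T' := (T.erase x).erase (p 1) with hT'
  have hadd : (almostBad G B L d T x).card + (almostBad G B L d (T.erase x) (p 1)).card ≤
      (col G L d T').card := by
    have hinj : Set.InjOn (restr d T') (almostBad G B L d T x : Set (W → C)) := by
      intro c hc c' hc' e
      rw [Finset.mem_coe, almostBad, Finset.mem_filter] at hc hc'
      obtain ⟨hc, q, hq, h1⟩ := hc
      obtain ⟨hc', q', hq', h1'⟩ := hc'
      have e1 := hp.eq hS hx hq
      have e2 := hp.eq hS hx hq'
      rw [← e1 1 (by omega), ← e1 3 (by omega)] at h1
      rw [← e2 1 (by omega), ← e2 3 (by omega)] at h1'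
      have hagree : ∀ v ∈ T', c v = c' v := by
        intro v hv
        have := congrFun e v
        rwa [restr_of_mem hv, restr_of_mem hv] at this
      funext v
      by_cases hv : v ∈ T.erase x
      · by_cases hv1 : v = p 1
        · subst hv1
          rw [h1, h1']
          refine hagree _ (Finset.mem_erase.2 ⟨fun e => ?_, hne 3 (by omega) (by omega)⟩)
          have := hp.1.2 _ (by omega) _ (by omega) e
          omega
        · exact hagree v (Finset.mem_erase.2 ⟨hv1, hv⟩)
      · rw [(mem_col.1 hc).1.2 v hv, (mem_col.1 hc').1.2 v hv]
    rw [← Finset.card_image_of_injOn hinj, ← Finset.card_union_of_disjoint]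
    · refine Finset.card_le_card (Finset.union_subset ?_ (Finset.filter_subset _ _))
      intro c hc
      obtain ⟨c', hc', rfl⟩ := Finset.mem_image.1 hc
      exact restr_mem_col hsub (Finset.mem_filter.1 hc').1
    · rw [Finset.disjoint_left]
      intro c hc hc2
      obtain ⟨c', hc', rfl⟩ := Finset.mem_image.1 hc
      rw [almostBad, Finset.mem_filter] at hc' hc2
      obtain ⟨hc', q, hq, h1⟩ := hc'
      obtain ⟨-, s, hs, h2⟩ := hc2
      have e1 := hp.eq hS hx hq
      rw [← e1 1 (by omega), ← e1 3 (by omega)] at h1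
      have hs3 : IsInner G B (T.erase x) (p 1) s 3 :=
        ⟨hs.1.mono (by omega), hs.2.1, fun i hi => hs.2.2 i (by omega)⟩
      have e2 := hp'.eq hS hend hs3
      have hsT' : ∀ i, 0 < i → i < 4 → s i ∈ T' := by
        intro i h3 h4
        refine Finset.mem_erase.2 ⟨fun e => ?_, (hs.2.2 i h4).1⟩
        rw [← hs.2.1] at e
        have := hs.1.2 i h4 0 (by omega) e
        omega
      rw [restr_of_mem (hsT' 1 (by omega) (by omega)),
        restr_of_mem (hsT' 3 (by omega) (by omega))] at h2
      refine (mem_col.1 hc').2 2 s (by omega) hs.1 (fun i hi => (hs.2.2 i hi).1) ?_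
      intro i hi
      interval_cases i
      · rw [← e2 0 (by omega), ← e2 2 (by omega)]
        exact h1
      · exact h2
  exact hadd

/-! ### Trails weighted by the branching -/

/-- The lists of `n` vertices by which a walk arriving at `y` from `u` can continue without
turning back. -/
noncomputable def trails (G : SimpleGraph W) : ℕ → W → W → Finset (List W)
  | 0, _, _ => {[]}
  | n + 1, u, y =>
    ((G.neighborFinset y).erase u).biUnion fun z => (trails G n y z).image (List.cons z)

/-- A weight whose product with the number of continuations at `v` is at most one. Continuations
are unique outside the branch vertices; at a branch vertex one is added to the degree, which makes
the weight positive at isolated vertices. -/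
noncomputable def weight (G : SimpleGraph W) (B : Finset W) (v : W) : ℝ :=
  if v ∈ B then ((G.neighborFinset v).card + 1 : ℝ)⁻¹ else 1

/-- The weight of a list of vertices. -/
noncomputable def listWeight (G : SimpleGraph W) (B : Finset W) (l : List W) : ℝ :=
  (l.map (weight G B)).prod

theorem weight_nonneg (v : W) : 0 ≤ weight G B v := by
  unfold weight; split_ifs <;> positivity

theorem weight_le_one (v : W) : weight G B v ≤ 1 := by
  unfold weight
  split_ifs
  · exact inv_le_one_of_one_le₀ (by linarith [Nat.cast_nonneg (α := ℝ) (G.neighborFinset v).card])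
  · exact le_rfl

theorem listWeight_nonneg (l : List W) : 0 ≤ listWeight G B l := by
  refine List.prod_nonneg fun a ha => ?_
  obtain ⟨v, -, rfl⟩ := List.mem_map.1 ha
  exact weight_nonneg v

theorem listWeight_cons (v : W) (l : List W) :
    listWeight G B (v :: l) = weight G B v * listWeight G B l := by
  simp [listWeight]

theorem sum_trails_succ (n : ℕ) (u y : W) :
    ∑ l ∈ trails G (n + 1) u y, listWeight G B l =
      ∑ z ∈ (G.neighborFinset y).erase u,
        weight G B z * ∑ l ∈ trails G n y z, listWeight G B l := by
  rw [trails, Finset.sum_biUnion]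
  · refine Finset.sum_congr rfl fun z _ => ?_
    rw [Finset.sum_image (fun a _ b _ h => (List.cons.inj h).2), Finset.mul_sum]
    exact Finset.sum_congr rfl fun l _ => listWeight_cons z l
  · intro z _ z' _ hz
    rw [Function.onFun, Finset.disjoint_left]
    intro l h1 h2
    obtain ⟨a, -, rfl⟩ := Finset.mem_image.1 h1
    obtain ⟨b, -, h⟩ := Finset.mem_image.1 h2
    exact hz (List.cons.inj h).1.symm

/-- The weights of the vertices behave like the probabilities of a random walk that does not turn
back. -/
theorem weight_mul_sum_trails_le (hS : IsSparse G B L r) (n : ℕ) {u y : W} (h : G.Adj y u) :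
    weight G B y * ∑ l ∈ trails G n u y, listWeight G B l ≤ 1 := by
  induction n generalizing u y with
  | zero => simpa [trails, listWeight] using weight_le_one y
  | succ n ih =>
    rw [sum_trails_succ]
    have h1 : ∑ z ∈ (G.neighborFinset y).erase u,
        weight G B z * ∑ l ∈ trails G n y z, listWeight G B l ≤
          (((G.neighborFinset y).erase u).card : ℝ) := by
      rw [← nsmul_one, ← Finset.sum_const]
      refine Finset.sum_le_sum fun z hz => ih ?_
      exact ((G.mem_neighborFinset y z).1 (Finset.mem_of_mem_erase hz)).symm
    refine le_trans (mul_le_mul_of_nonneg_left h1 (weight_nonneg y)) ?_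
    by_cases hy : y ∈ B
    · rw [weight, if_pos hy, inv_mul_le_iff₀ (by positivity), mul_one]
      have : ((G.neighborFinset y).erase u).card ≤ (G.neighborFinset y).card :=
        Finset.card_le_card (Finset.erase_subset _ _)
      exact_mod_cast this.trans (Nat.le_succ _)
    · rw [weight, if_neg hy, one_mul]
      have : ((G.neighborFinset y).erase u).card ≤ 1 := by
        rw [Finset.card_le_one]
        intro a ha b hb
        rw [Finset.mem_erase, mem_neighborFinset] at ha hb
        rcases hS.deg_le_two y hy a b u ha.2 hb.2 h with e | e | e
        · exact e
        · exact absurd e ha.1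
        · exact absurd e hb.1
      exact_mod_cast this

theorem sum_trails_le_two (hS : IsSparse G B L r) (n : ℕ) {x : W} (hx : x ∉ B) :
    ∑ l ∈ trails G n x x, listWeight G B l ≤ 2 := by
  cases n with
  | zero => simp [trails, listWeight]
  | succ n =>
    rw [sum_trails_succ]
    have h1 : ∑ z ∈ (G.neighborFinset x).erase x,
        weight G B z * ∑ l ∈ trails G n x z, listWeight G B l ≤
          (((G.neighborFinset x).erase x).card : ℝ) := by
      rw [← nsmul_one, ← Finset.sum_const]
      refine Finset.sum_le_sum fun z hz => weight_mul_sum_trails_le hS n ?_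
      exact ((G.mem_neighborFinset x z).1 (Finset.mem_of_mem_erase hz)).symm
    refine h1.trans ?_
    have : ((G.neighborFinset x).erase x).card ≤ 2 := by
      by_contra hcon
      obtain ⟨a, b, c, ha, hb, hc, hab, hac, hbc⟩ := Finset.two_lt_card_iff.1 (not_le.1 hcon)
      rw [Finset.mem_erase, mem_neighborFinset] at ha hb hc
      rcases hS.deg_le_two x hx a b c ha.2 hb.2 hc.2 with e | e | e
      all_goals contradiction
    exact_mod_cast this

theorem IsPathSeq.mem_trails_aux {p : ℕ → W} {n : ℕ} (hp : IsPathSeq G p (n + 2)) :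
    (List.range n).map (fun i => p (i + 2)) ∈ trails G n (p 0) (p 1) := by
  induction n generalizing p with
  | zero => simp [trails]
  | succ n ih =>
    have h := ih (p := fun i => p (i + 1))
      (by simpa [add_comm] using hp.shift (m := n + 2) 1 (by omega))
    rw [trails, Finset.mem_biUnion]
    refine ⟨p 2, ?_, ?_⟩
    · rw [Finset.mem_erase, mem_neighborFinset]
      refine ⟨fun e => ?_, hp.1 1 (by omega)⟩
      have := hp.2 _ (by omega) _ (by omega) e
      omega
    · rw [List.range_succ_eq_map, List.map_cons, List.map_map]
      exact Finset.mem_image_of_mem _ h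

theorem IsPathSeq.mem_trails {p : ℕ → W} {n : ℕ} (hp : IsPathSeq G p (n + 1)) :
    (List.range n).map (fun i => p (i + 1)) ∈ trails G n (p 0) (p 0) := by
  cases n with
  | zero => simp [trails]
  | succ n =>
    have h := hp.mem_trails_aux
    rw [trails, Finset.mem_biUnion]
    refine ⟨p 1, ?_, ?_⟩
    · rw [Finset.mem_erase, mem_neighborFinset]
      exact ⟨(hp.1 0 (by omega)).ne', hp.1 0 (by omega)⟩
    · rw [List.range_succ_eq_map, List.map_cons, List.map_map]
      exact Finset.mem_image_of_mem _ h

theorem listWeight_map_range (f : ℕ → W) (n : ℕ) :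
    listWeight G B ((List.range n).map f) = ∏ i ∈ range n, weight G B (f i) := by
  induction n with
  | zero => simp [listWeight]
  | succ n ih =>
    rw [Finset.prod_range_succ, ← ih]
    simp [listWeight, List.range_succ]

/-- The factor that a branch vertex contributes to the number of paths, doubled to compensate
for its colour not being counted. -/
noncomputable def branchCost (G : SimpleGraph W) (B : Finset W) (v : W) : ℝ :=
  if v ∈ B then 2 * ((G.neighborFinset v).card + 1 : ℝ) else 1

theorem branchCost_nonneg (v : W) : 0 ≤ branchCost G B v := by
  unfold branchCost
  split_ifs
  · positivity
  · exact zero_le_one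

theorem branchTwo_eq (v : W) : (branchTwo B v : ℝ) = weight G B v * branchCost G B v := by
  unfold branchTwo weight branchCost
  split_ifs
  · have : ((G.neighborFinset v).card + 1 : ℝ) ≠ 0 := by positivity
    push_cast
    field_simp
  · norm_num

/-- Each branch vertex `b` on the path is followed by `r b` other vertices, or is the last
one and satisfies `r b < t`. -/
theorem IsPathSeq.prod_branchCost_le (hS : IsSparse G B L r) {t : ℕ} (n : ℕ) {p : ℕ → W}
    (hp : IsPathSeq G p n) (ht : ∀ i < n, p i ∈ B → r (p i) < t) :
    ∏ i ∈ range n, branchCost G B (p i) ≤ (1001 / 1000 : ℝ) ^ (n + t) := by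
  induction n using Nat.strong_induction_on generalizing p with
  | _ n ih =>
    match n, ih, hp, ht with
    | 0, _, _, _ =>
      rw [Finset.prod_range_zero]
      exact one_le_pow₀ (by norm_num)
    | n + 1, ih, hp, ht =>
      rw [Finset.prod_range_succ']
      by_cases h0 : p 0 ∈ B
      · have hc : branchCost G B (p 0) ≤ (1001 / 1000 : ℝ) ^ (r (p 0)) := by
          rw [branchCost, if_pos h0]; exact hS.degree_le _ h0
        have hone : ∀ i < n, i < r (p 0) → branchCost G B (p (i + 1)) = 1 := by
          intro i hi hir
          exact if_neg (hS.ball p (i + 1) (hp.mono (by omega)) h0 (by omega) (i + 1)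
            (by omega) le_rfl).1
        rcases Nat.lt_or_ge (r (p 0)) n with h | h
        · obtain ⟨m, rfl⟩ := Nat.exists_eq_add_of_le h.le
          rw [Finset.prod_range_add, Finset.prod_eq_one (fun i hi => hone i (by
            rw [Finset.mem_range] at hi; omega) (Finset.mem_range.1 hi)), one_mul]
          have := ih m (by omega) (p := fun i => p (r (p 0) + 1 + i)) (hp.shift _ (by omega))
            (fun i hi => ht _ (by omega))
          have e : ∀ i, p (r (p 0) + 1 + i) = p (r (p 0) + i + 1) := fun i => by
            congr 1; omega
          simp only [e] at this
          calc _ ≤ (1001 / 1000 : ℝ) ^ (m + t) * (1001 / 1000 : ℝ) ^ (r (p 0)) := by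
                  gcongr
                  exact branchCost_nonneg _
            _ = (1001 / 1000 : ℝ) ^ (m + t + r (p 0)) := by rw [← pow_add]
            _ ≤ _ := pow_le_pow_right₀ (by norm_num) (by omega)
        · rw [Finset.prod_eq_one (fun i hi => hone i (Finset.mem_range.1 hi)
            (lt_of_lt_of_le (Finset.mem_range.1 hi) h)), one_mul]
          refine hc.trans (pow_le_pow_right₀ (by norm_num) ?_)
          have := ht 0 (by omega) h0
          omega
      · have := ih n (by omega) (p := fun i => p (i + 1))
          (by simpa [add_comm] using hp.shift (m := n) 1 (by omega))
          (fun i hi => ht _ (by omega))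
        rw [branchCost, if_neg h0, mul_one]
        exact this.trans (pow_le_pow_right₀ (by norm_num) (by omega))

theorem IsPathSeq.prod_branchTwo_le (hS : IsSparse G B L r) {t n : ℕ} {p : ℕ → W}
    (hp : IsPathSeq G p n) (ht : ∀ i < n, p i ∈ B → r (p i) < t) :
    ((∏ i ∈ range n, branchTwo B (p i) : ℕ) : ℝ) ≤
      listWeight G B ((List.range n).map p) * (1001 / 1000 : ℝ) ^ (n + t) := by
  rw [Nat.cast_prod, Finset.prod_congr rfl fun i _ => branchTwo_eq (G := G) (p i),
    Finset.prod_mul_distrib, listWeight_map_range]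
  exact mul_le_mul_of_nonneg_left (hp.prod_branchCost_le hS n ht)
    (Finset.prod_nonneg fun i _ => weight_nonneg _)

theorem IsPathSeq.le_card {p : ℕ → W} {n : ℕ} (hp : IsPathSeq G p n) :
    n ≤ Fintype.card W := by
  rw [← Finset.card_range n, ← Finset.card_univ]
  exact Finset.card_le_card_of_injOn p (fun _ _ => by simp) fun i hi j hj e =>
    hp.2 i (by simpa using hi) j (by simpa using hj) e

/-! ### Paths through branch vertices -/

/-- A repetitive path through a branch vertex has halves longer than the radius, since the colour
of the branch vertex does not occur within that radius. -/
theorem IsSparse.radius_lt (hS : IsSparse G B L r) {c : W → C} {p : ℕ → W} {t i : ℕ}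
    (hp : IsPathSeq G p (2 * t)) (hc : ∀ i < 2 * t, c (p i) ∈ L (p i)) (hrep : IsRep c p t)
    (hi : i < 2 * t) (hb : p i ∈ B) : r (p i) < t := by
  by_contra hcon
  rw [not_lt] at hcon
  rcases Nat.lt_or_ge i t with h | h
  · have := (hS.ball (fun k => p (i + k)) t (hp.shift i (by omega)) hb hcon t (by omega)
      le_rfl).2
    refine Finset.disjoint_left.1 this (hc i hi) ?_
    rw [hrep i h, add_comm t i]
    exact hc _ (by omega)
  · have := (hS.ball (fun k => p (i - k)) t (hp.reverse hi (by omega)) hb hcon t (by omega)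
      le_rfl).2
    refine Finset.disjoint_left.1 this (hc i hi) ?_
    have e := hrep (i - t) (by omega)
    rw [show t + (i - t) = i by omega] at e
    rw [← e]
    exact hc _ (by omega)

/-- The colourings of `T` that are repetitive on a path of `2 * t` vertices through `x` and
some branch vertex. -/
noncomputable def badCross (G : SimpleGraph W) (B : Finset W) (L : W → Finset C) (d : W → C)
    (T : Finset W) (x : W) : Finset (W → C) :=
  (extCol G L d T x).filter fun c => ∃ t p j, IsPathSeq G p (2 * t) ∧ (∀ i < 2 * t, p i ∈ T) ∧
    j < 2 * t ∧ p j = x ∧ IsRep c p t ∧ ∃ i < 2 * t, p i ∈ B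

/-- The colourings of `T` that are repetitive on the path of `2 * t` vertices with `x` in
position `j`, the vertices `l₁` before `x` (in reverse order) and `l₂` after `x`. -/
noncomputable def badCode (G : SimpleGraph W) (L : W → Finset C) (d : W → C)
    (T : Finset W) (x : W) (t j : ℕ) (l₁ l₂ : List W) : Finset (W → C) :=
  (extCol G L d T x).filter fun c => ∃ p, IsPathSeq G p (2 * t) ∧ (∀ i < 2 * t, p i ∈ T) ∧
    p j = x ∧ IsRep c p t ∧ (List.range j).map (fun i => p (j - (i + 1))) = l₁ ∧
    (List.range (2 * t - 1 - j)).map (fun i => p (j + (i + 1))) = l₂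

theorem Grows.card_badCode_le (hS : IsSparse G B L r) {T : Finset W} {x : W} (hx : x ∉ B)
    (hN : Grows G B L d T.card) {t j : ℕ} (hj : j < 2 * t) (l₁ l₂ : List W) :
    ((badCode G L d T x t j l₁ l₂).card : ℝ) ≤
      2 * (col G L d (T.erase x)).card * (((1001 / 1000) ^ 4 / 2) ^ t) *
        (listWeight G B l₁ * listWeight G B l₂) := by
  rcases (badCode G L d T x t j l₁ l₂).eq_empty_or_nonempty with h | ⟨c₀, hc₀⟩
  · rw [h, Finset.card_empty, Nat.cast_zero]
    have := listWeight_nonneg (G := G) (B := B) l₁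
    have := listWeight_nonneg (G := G) (B := B) l₂
    positivity
  · obtain ⟨hc₀, p, hp, hpT, rfl, hrep, h1, h2⟩ := Finset.mem_filter.1 hc₀
    rw [mem_extCol] at hc₀
    have hr : ∀ i < 2 * t, p i ∈ B → r (p i) < t := fun i hi hb =>
      hS.radius_lt hp (fun i hi => hc₀.1.1 _ (hpT i hi)) hrep hi hb
    have key := hN.card_isRep_le hS hp hpT hj hx
    have hq1 := (hp.reverse (m := j + 1) hj (by omega)).shift (m := j) 1 (by omega)
    simp only [add_comm 1] at hq1
    have b1 := hq1.prod_branchTwo_le hS (t := t) (fun i hi => hr _ (by omega))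
    have hq2 := hp.shift (m := 2 * t - 1 - j) (j + 1) (by omega)
    simp only [add_assoc, add_comm 1] at hq2
    have b2 := hq2.prod_branchTwo_le hS (t := t) (fun i hi => hr _ (by omega))
    rw [h1] at b1
    rw [h2] at b2
    have hsub : (badCode G L d T (p j) t j l₁ l₂).card ≤
        ((extCol G L d T (p j)).filter fun c => IsRep c p t).card := by
      refine Finset.card_le_card fun c hc => ?_
      obtain ⟨hc, q, hq, hqT, hqj, hrepq, e1, e2⟩ := Finset.mem_filter.1 hc
      have hpq : ∀ i < 2 * t, p i = q i := by
        intro i hi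
        rcases lt_trichotomy i j with h | h | h
        · have := List.map_inj_left.1 (h1.trans e1.symm) (j - 1 - i)
            (List.mem_range.2 (by omega))
          rwa [show j - (j - 1 - i + 1) = i by omega] at this
        · rw [h, hqj]
        · have := List.map_inj_left.1 (h2.trans e2.symm) (i - 1 - j)
            (List.mem_range.2 (by omega))
          rwa [show j + (i - 1 - j + 1) = i by omega] at this
      refine Finset.mem_filter.2 ⟨hc, fun i hi => ?_⟩
      rw [hpq i (by omega), hpq (t + i) (by omega)]
      exact hrepq i hi
    have key2 : ((badCode G L d T (p j) t j l₁ l₂).card : ℝ) * 2 ^ t ≤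
        2 * (col G L d (T.erase (p j))).card *
          (((∏ i ∈ range j, branchTwo B (p (j - (i + 1))) : ℕ) : ℝ) *
          ((∏ i ∈ range (2 * t - 1 - j), branchTwo B (p (j + (i + 1))) : ℕ) : ℝ)) := by
      exact_mod_cast (Nat.mul_le_mul_right _ hsub).trans key
    have hw1 := listWeight_nonneg (G := G) (B := B) l₁
    have hw2 := listWeight_nonneg (G := G) (B := B) l₂
    have hpow : (1001 / 1000 : ℝ) ^ (j + t) * (1001 / 1000 : ℝ) ^ (2 * t - 1 - j + t) ≤
        ((1001 / 1000) ^ 4) ^ t := by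
      rw [← pow_add, ← pow_mul]
      exact pow_le_pow_right₀ (by norm_num) (by omega)
    rw [div_pow, mul_div_assoc', div_mul_eq_mul_div, le_div_iff₀ (by positivity)]
    refine key2.trans ?_
    rw [mul_assoc (2 * ((col G L d (T.erase (p j))).card : ℝ))]
    refine mul_le_mul_of_nonneg_left ?_ (by positivity)
    calc _ ≤ (listWeight G B l₁ * (1001 / 1000 : ℝ) ^ (j + t)) *
          (listWeight G B l₂ * (1001 / 1000 : ℝ) ^ (2 * t - 1 - j + t)) := by
            gcongr
      _ = (1001 / 1000 : ℝ) ^ (j + t) * (1001 / 1000 : ℝ) ^ (2 * t - 1 - j + t) *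
          (listWeight G B l₁ * listWeight G B l₂) := by ring
      _ ≤ _ := by gcongr

theorem sixteen_mul_le_pow (t : ℕ) (ht : 40 ≤ t) : (16 * t : ℝ) ≤ (5 / 4) ^ t := by
  induction t, ht using Nat.le_induction with
  | base => norm_num
  | succ n hn ih =>
    have : (40 : ℝ) ≤ n := by exact_mod_cast hn
    rw [pow_succ]
    push_cast
    linarith

/-- With `j` ranging over `2 * t` positions and total weight at most `2` on each side of `x`, the
paths with `2 * t` vertices exclude at most the proportion `16 * t * (Q ^ 4 / 2) ^ t ≤ (3 / 4) ^ t`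
of the colourings, where `Q = 1001 / 1000`, and `t ≥ 40` as the radii are at least `40`. -/
theorem Grows.card_badCross_le (hS : IsSparse G B L r) {T : Finset W} {x : W} (hx : x ∉ B)
    (hN : Grows G B L d T.card) :
    ((badCross G B L d T x).card : ℝ) ≤ 1 / 20 * (col G L d (T.erase x)).card := by
  set K : ℝ := ((col G L d (T.erase x)).card : ℝ) with hK
  have hK0 : 0 ≤ K := Nat.cast_nonneg _
  have hsub : badCross G B L d T x ⊆ (Ico 40 (Fintype.card W + 1)).biUnion fun t =>
      (range (2 * t)).biUnion fun j => (trails G j x x).biUnion fun l₁ =>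
        (trails G (2 * t - 1 - j) x x).biUnion fun l₂ => badCode G L d T x t j l₁ l₂ := by
    intro c hc
    obtain ⟨hc, t, p, j, hp, hpT, hj, rfl, hrep, i, hi, hb⟩ := Finset.mem_filter.1 hc
    have h1 : r (p i) < t :=
      hS.radius_lt hp (fun i hi => (mem_extCol.1 hc).1.1 _ (hpT i hi)) hrep hi hb
    have h2 := hS.le_radius _ hb
    have h3 := hp.le_card
    simp only [Finset.mem_biUnion]
    refine ⟨t, Finset.mem_Ico.2 (by omega), j, Finset.mem_range.2 hj, _, ?_, _, ?_,
      Finset.mem_filter.2 ⟨hc, p, hp, hpT, rfl, hrep, rfl, rfl⟩⟩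
    · exact (hp.reverse (m := j + 1) hj (by omega)).mem_trails
    · exact (hp.shift (m := 2 * t - 1 - j + 1) j (by omega)).mem_trails
  have hcodes : ∀ t ∈ Ico 40 (Fintype.card W + 1), (((range (2 * t)).biUnion fun j =>
      (trails G j x x).biUnion fun l₁ => (trails G (2 * t - 1 - j) x x).biUnion fun l₂ =>
        badCode G L d T x t j l₁ l₂).card : ℝ) ≤ K * (3 / 4) ^ t := by
    intro t ht
    have hj : ∀ j ∈ range (2 * t), (((trails G j x x).biUnion fun l₁ =>
        (trails G (2 * t - 1 - j) x x).biUnion fun l₂ =>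
          badCode G L d T x t j l₁ l₂).card : ℝ) ≤ 8 * K * (((1001 / 1000) ^ 4 / 2) ^ t) := by
      intro j hj
      set A : ℝ := 2 * K * (((1001 / 1000) ^ 4 / 2) ^ t) with hA
      have hA0 : 0 ≤ A := by positivity
      calc _ ≤ ∑ l₁ ∈ trails G j x x, ∑ l₂ ∈ trails G (2 * t - 1 - j) x x,
            ((badCode G L d T x t j l₁ l₂).card : ℝ) := by
              exact_mod_cast Finset.card_biUnion_le.trans
                (Finset.sum_le_sum fun l₁ _ => Finset.card_biUnion_le)
        _ ≤ ∑ l₁ ∈ trails G j x x, ∑ l₂ ∈ trails G (2 * t - 1 - j) x x,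
            A * (listWeight G B l₁ * listWeight G B l₂) :=
              Finset.sum_le_sum fun l₁ _ => Finset.sum_le_sum fun l₂ _ =>
                hN.card_badCode_le hS hx (Finset.mem_range.1 hj) l₁ l₂
        _ = A * ((∑ l₁ ∈ trails G j x x, listWeight G B l₁) *
            ∑ l₂ ∈ trails G (2 * t - 1 - j) x x, listWeight G B l₂) := by
              rw [Finset.sum_mul_sum, Finset.mul_sum]
              exact Finset.sum_congr rfl fun _ _ => by rw [Finset.mul_sum]
        _ ≤ A * (2 * 2) := by
              refine mul_le_mul_of_nonneg_left ?_ hA0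
              exact mul_le_mul (sum_trails_le_two hS _ hx) (sum_trails_le_two hS _ hx)
                (Finset.sum_nonneg fun _ _ => listWeight_nonneg _) (by norm_num)
        _ = _ := by rw [hA]; ring
    have h16 := sixteen_mul_le_pow t (Finset.mem_Ico.1 ht).1
    calc _ ≤ ∑ j ∈ range (2 * t), (((trails G j x x).biUnion fun l₁ =>
          (trails G (2 * t - 1 - j) x x).biUnion fun l₂ =>
            badCode G L d T x t j l₁ l₂).card : ℝ) := by
              exact_mod_cast Finset.card_biUnion_le
      _ ≤ ∑ j ∈ range (2 * t), 8 * K * (((1001 / 1000) ^ 4 / 2) ^ t) := Finset.sum_le_sum hj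
      _ = K * ((16 * t) * (((1001 / 1000) ^ 4 / 2) ^ t)) := by
            rw [Finset.sum_const, Finset.card_range, nsmul_eq_mul]; push_cast; ring
      _ ≤ K * ((5 / 4) ^ t * (((1001 / 1000) ^ 4 / 2) ^ t)) := by gcongr
      _ = K * ((5 / 4 * ((1001 / 1000) ^ 4 / 2)) ^ t) := by rw [mul_pow]
      _ ≤ K * (3 / 4) ^ t := by
            gcongr
            norm_num
  calc ((badCross G B L d T x).card : ℝ) ≤
        ∑ t ∈ Ico 40 (Fintype.card W + 1), (((range (2 * t)).biUnion fun j =>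
          (trails G j x x).biUnion fun l₁ => (trails G (2 * t - 1 - j) x x).biUnion fun l₂ =>
            badCode G L d T x t j l₁ l₂).card : ℝ) := by
            exact_mod_cast (Finset.card_le_card hsub).trans Finset.card_biUnion_le
    _ ≤ ∑ t ∈ Ico 40 (Fintype.card W + 1), K * (3 / 4) ^ t := Finset.sum_le_sum hcodes
    _ = K * ∑ t ∈ Ico 40 (Fintype.card W + 1), (3 / 4 : ℝ) ^ t := by rw [Finset.mul_sum]
    _ ≤ K * ((3 / 4) ^ 40 / (1 - 3 / 4)) := by
          refine mul_le_mul_of_nonneg_left ?_ hK0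
          exact geom_sum_Ico_le_of_lt_one (by norm_num) (by norm_num)
    _ ≤ 1 / 20 * K := by
          rw [mul_comm]
          refine mul_le_mul_of_nonneg_right ?_ hK0
          norm_num

/-! ### Growth of the number of colourings -/

/-- If adding `x` creates a repetitive path, then that path meets a branch vertex or starts
at `x`. -/
theorem extCol_subset {T : Finset W} {x : W} (hx : IsEnd G B T x) :
    extCol G L d T x ⊆ col G L d T ∪ (badInner G B L d T x 1 ∪ (badInner G B L d T x 2 ∪
      ((Ico 3 (Fintype.card W + 1)).biUnion (badInner G B L d T x) ∪ badCross G B L d T x))) := by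
  intro c hc
  have hc' := mem_extCol.1 hc
  simp only [Finset.mem_union, Finset.mem_biUnion]
  by_cases hcol : c ∈ col G L d T
  · exact Or.inl hcol
  right
  have : ¬ NonrepOn G T c := fun h => hcol (mem_col.2 ⟨hc'.1, h⟩)
  simp only [NonrepOn, not_forall, not_not] at this
  obtain ⟨t, p, ht, hp, hpT, hrep⟩ := this
  -- the repetitive path contains `x`, since the colouring is nonrepetitive without `x`
  obtain ⟨j, hj, hjx⟩ : ∃ j < 2 * t, p j = x := by
    by_contra hcon
    push Not at hcon
    have hpe : ∀ i < 2 * t, p i ∈ T.erase x := fun i hi =>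
      Finset.mem_erase.2 ⟨hcon i hi, hpT i hi⟩
    refine (mem_col.1 hc'.2).2 t p ht hp hpe fun i hi => ?_
    rw [restr_of_mem (hpe i (by omega)), restr_of_mem (hpe (t + i) (by omega))]
    exact hrep i hi
  by_cases hB : ∃ i < 2 * t, p i ∈ B
  · exact Or.inr (Or.inr (Or.inr (Finset.mem_filter.2
      ⟨hc, t, p, j, hp, hpT, hj, hjx, hrep, hB⟩)))
  · push Not at hB
    have hbad : c ∈ badInner G B L d T x t := by
      -- an end can only be the first or the last vertex of the path
      have hj' : j = 0 ∨ j = 2 * t - 1 := by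
        by_contra hcon
        have h1 := hp.1 (j - 1) (by omega)
        rw [show j - 1 + 1 = j by omega, hjx] at h1
        have h2 := hp.1 j (by omega)
        rw [hjx] at h2
        have := hp.2 _ (by omega) _ (by omega) (hx.2.2 _ (hpT (j - 1) (by omega))
          (hB _ (by omega)) _ (hpT (j + 1) (by omega)) (hB _ (by omega)) h1.symm h2)
        omega
      refine Finset.mem_filter.2 ⟨hc, ?_⟩
      rcases hj' with h | h
      · subst h
        exact ⟨p, ⟨hp, hjx, fun i hi => ⟨hpT i hi, hB i hi⟩⟩, hrep⟩
      · subst h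
        exact ⟨fun i => p (2 * t - 1 - i), ⟨hp.reverse (by omega) (by omega), hjx, fun i hi =>
          ⟨hpT _ (by omega), hB _ (by omega)⟩⟩, hrep.reverse⟩
    have hcard := hp.le_card
    rcases Nat.lt_or_ge t 3 with h | h
    · interval_cases t
      · exact Or.inl hbad
      · exact Or.inr (Or.inl hbad)
    · exact Or.inr (Or.inr (Or.inl ⟨t, Finset.mem_Ico.2 ⟨h, by omega⟩, hbad⟩))

/-- A lower bound for the number of colourings in which the repetitions of four vertices are
counted exactly, and all longer ones are estimated. -/
theorem Grows.step (hS : IsSparse G B L r) {T : Finset W} {x : W} (hN : Grows G B L d T.card)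
    (hx : IsEnd G B T x) :
    3 * ((col G L d (T.erase x)).card : ℝ) ≤ (col G L d T).card +
      (almostBad G B L d T x).card + 11 / 20 * (col G L d (T.erase x)).card := by
  set K : ℝ := ((col G L d (T.erase x)).card : ℝ) with hK
  have hK0 : 0 ≤ K := Nat.cast_nonneg _
  have h4 : 4 * K ≤ (extCol G L d T x).card := by
    have := card_mul_le_card_extCol (G := G) (L := L) (d := d) hx.1
    have := (Nat.mul_le_mul_right (col G L d (T.erase x)).card (hS.four_le x hx.2.1)).trans this
    rw [hK]
    exact_mod_cast this
  have hinner : ∀ t, 0 < t →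
      ((badInner G B L d T x t).card : ℝ) ≤ 2 * K * (1 / 2) ^ t := by
    intro t ht
    rw [one_div, inv_pow, ← div_eq_mul_inv, le_div_iff₀ (by positivity), hK]
    exact_mod_cast hN.card_badInner_le hS hx ht
  have h1 := hinner 1 one_pos
  have h2 : ((badInner G B L d T x 2).card : ℝ) ≤ (almostBad G B L d T x).card := by
    exact_mod_cast card_badInner_two_le hS hx
  have h3 : ((((Ico 3 (Fintype.card W + 1)).biUnion (badInner G B L d T x)).card : ℕ) : ℝ) ≤
      1 / 2 * K := by
    calc _ ≤ ∑ t ∈ Ico 3 (Fintype.card W + 1), ((badInner G B L d T x t).card : ℝ) := by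
            exact_mod_cast Finset.card_biUnion_le
      _ ≤ ∑ t ∈ Ico 3 (Fintype.card W + 1), 2 * K * (1 / 2) ^ t :=
            Finset.sum_le_sum fun t ht => hinner t (by have := Finset.mem_Ico.1 ht; omega)
      _ = 2 * K * ∑ t ∈ Ico 3 (Fintype.card W + 1), (1 / 2 : ℝ) ^ t := by rw [Finset.mul_sum]
      _ ≤ 2 * K * ((1 / 2) ^ 3 / (1 - 1 / 2)) :=
            mul_le_mul_of_nonneg_left
              (geom_sum_Ico_le_of_lt_one (by norm_num) (by norm_num)) (by positivity)
      _ = 1 / 2 * K := by ring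
  have h5 := hN.card_badCross_le hS hx.2.1
  have hunion : ((extCol G L d T x).card : ℝ) ≤ (col G L d T).card +
      ((badInner G B L d T x 1).card + ((badInner G B L d T x 2).card +
        (((Ico 3 (Fintype.card W + 1)).biUnion (badInner G B L d T x)).card +
          (badCross G B L d T x).card))) := by
    have := Finset.card_le_card (extCol_subset (L := L) (d := d) hx)
    have := this.trans (Finset.card_union_le _ _)
    have := this.trans (Nat.add_le_add_left (Finset.card_union_le _ _) _)
    have := this.trans (Nat.add_le_add_left (Nat.add_le_add_left
      (Finset.card_union_le _ _) _) _)
    have := this.trans (Nat.add_le_add_left (Nat.add_le_add_left (Nat.add_le_add_left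
      (Finset.card_union_le _ _) _) _) _)
    exact_mod_cast this
  rw [← hK] at h5
  linarith

/-- If `a` and `a'` denote the numbers of colourings in `almostBad` for `x` and for the next
vertex `y`, and `C₀`, `C₁`, `C₂` the numbers of colourings of `T`, `T - x`, `T - x - y`, then
`C₀ ≥ 2.45 C₁ - a` and `C₁ ≥ 2.45 C₂ - a'` with `a + a' ≤ C₂`. Hence `a ≤ C₁ / 2.45`, and
`C₀ ≥ 2 C₁`. -/
theorem grows (hS : IsSparse G B L r) (d : W → C) (N : ℕ) : Grows G B L d N := by
  induction N with
  | zero => intro T x hT; omega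
  | succ N ih =>
    intro T x hT hx
    rcases Nat.lt_or_ge T.card N with h | h
    · exact ih T x h hx
    obtain rfl : T.card = N := by omega
    have hmono : ∀ {M}, M ≤ T.card → Grows G B L d M := fun hM T' x' hT' =>
      ih T' x' (lt_of_lt_of_le hT' hM)
    have s0 := ih.step hS hx
    have key : 2 * ((col G L d (T.erase x)).card : ℝ) ≤ (col G L d T).card := by
      rcases (almostBad G B L d T x).eq_empty_or_nonempty with hA | ⟨c, hc⟩
      · rw [hA, Finset.card_empty, Nat.cast_zero] at s0
        have : (0 : ℝ) ≤ (col G L d (T.erase x)).card := Nat.cast_nonneg _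
        linarith
      · obtain ⟨-, p, hp, -⟩ := Finset.mem_filter.1 hc
        obtain ⟨hy, hadd⟩ := card_almostBad_add_le (d := d) hS hx hp
        have s1 := (hmono (Finset.card_le_card (Finset.erase_subset x T))).step hS hy
        have hadd' : ((almostBad G B L d T x).card : ℝ) +
            (almostBad G B L d (T.erase x) (p 1)).card ≤
              (col G L d ((T.erase x).erase (p 1))).card := by exact_mod_cast hadd
        have : (0 : ℝ) ≤ (almostBad G B L d (T.erase x) (p 1)).card := Nat.cast_nonneg _
        linarith
    exact_mod_cast key

/-- The branch vertices are coloured first, the others in an order in which each is an end when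
it is added. -/
theorem IsSparse.col_pos (hS : IsSparse G B L r) (hd : ∀ x, d x ∈ L x) (T : Finset W)
    (hBT : B ⊆ T) : 0 < (col G L d T).card := by
  induction hn : T.card using Nat.strong_induction_on generalizing T with
  | _ n ih =>
    rcases (T \ B).eq_empty_or_nonempty with h | h
    · obtain rfl : B = T := Finset.Subset.antisymm hBT (Finset.sdiff_eq_empty_iff_subset.1 h)
      refine Finset.card_pos.2 ⟨d, mem_col.2 ⟨⟨fun x _ => hd x, fun x _ => rfl⟩, ?_⟩⟩
      -- no two branch vertices are adjacent
      intro t p ht hp hpB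
      have h0 := hpB 0 (by omega)
      have := hS.le_radius _ h0
      exact absurd (hpB 1 (by omega))
        (hS.ball p 1 (hp.mono (by omega)) h0 (by omega) 1 one_pos le_rfl).1
    · obtain ⟨x, hx, hx'⟩ := hS.exists_end _ h fun y hy => (Finset.mem_sdiff.1 hy).2
      rw [Finset.mem_sdiff] at hx
      have hend : IsEnd G B T x := ⟨hx.1, hx.2, fun y hy hyB z hz hzB =>
        hx' y (Finset.mem_sdiff.2 ⟨hy, hyB⟩) z (Finset.mem_sdiff.2 ⟨hz, hzB⟩)⟩
      have h1 := ih _ (hn ▸ Finset.card_erase_lt_of_mem hx.1) (T.erase x)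
        (fun b hb => Finset.mem_erase.2 ⟨fun e => hx.2 (e ▸ hb), hBT hb⟩) rfl
      have h2 := grows hS d (T.card + 1) T x (by omega) hend
      omega

theorem IsSparse.exists_isNonrepetitive (hS : IsSparse G B L r) :
    ∃ c : W → C, (∀ x, c x ∈ L x) ∧ G.IsNonrepetitive c := by
  choose d hd using hS.nonempty
  obtain ⟨c, hc⟩ := Finset.card_pos.1 (hS.col_pos hd univ (Finset.subset_univ _))
  rw [mem_col] at hc
  refine ⟨c, fun x => hc.1.1 x (Finset.mem_univ x), ?_⟩
  rintro x y p hp ⟨t, ht, hrep⟩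
  refine hc.2 t p.getVert (by omega) ⟨fun i hi => ?_, fun i hi j hj e => ?_⟩
    (fun i _ => Finset.mem_univ _) hrep
  · exact p.adj_getVert_succ (by omega)
  · exact hp.getVert_injOn (by simp; omega) (by simp; omega) e

end Counting

/-! ### The neighbourhoods of branch vertices in a subdivision -/

section Subdivision

variable {V : Type*} {W : Type*} {H : SimpleGraph V} {G : SimpleGraph W} (S : H.Subdivision G)

theorem getVert_inj {a b : V} (h : H.Adj a b) {i j : ℕ} (hi : i ≤ (S.path h).length)
    (hj : j ≤ (S.path h).length) (e : (S.path h).getVert i = (S.path h).getVert j) : i = j :=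
  (S.isPath h).getVert_injOn hi hj e

theorem getVert_notMem_range {a b : V} (h : H.Adj a b) {i : ℕ} (h0 : 0 < i)
    (hi : i < (S.path h).length) : (S.path h).getVert i ∉ Set.range S.branch := by
  rintro ⟨z, hz⟩
  rcases S.eq_or_eq_of_branch_mem h z (hz ▸ (S.path h).getVert_mem_support i) with rfl | rfl
  · have := getVert_inj S h (Nat.zero_le _) hi.le ((S.path h).getVert_zero.trans hz)
    omega
  · have := getVert_inj S h le_rfl hi.le ((S.path h).getVert_length.trans hz)
    omega

/-- An inner vertex of a path lies on no other path, except for the same path traversed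
backwards. -/
theorem eq_or_eq_reverse {a b a' b' : V} (h : H.Adj a b) (h' : H.Adj a' b') {i j : ℕ}
    (h0 : 0 < i) (hi : i < (S.path h).length) (hj : j ≤ (S.path h').length)
    (e : (S.path h).getVert i = (S.path h').getVert j) :
    (a = a' ∧ b = b' ∧ i = j) ∨ (a = b' ∧ b = a' ∧ i + j = (S.path h).length) := by
  have hs : s(a, b) = s(a', b') := by
    by_contra hne
    exact getVert_notMem_range S h h0 hi (S.internally_disjoint h h' hne _
      ((S.path h).getVert_mem_support i) (e ▸ (S.path h').getVert_mem_support j))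
  rcases Sym2.eq_iff.1 hs with ⟨rfl, rfl⟩ | ⟨rfl, rfl⟩
  · exact Or.inl ⟨rfl, rfl, getVert_inj S h hi.le hj e⟩
  · right
    have hr : S.path h' = (S.path h).reverse := S.path_symm h
    rw [hr, Walk.length_reverse] at hj
    rw [hr, Walk.getVert_reverse] at e
    have := getVert_inj S h hi.le (by omega) e
    exact ⟨rfl, rfl, by omega⟩

theorem adj_getVert {a b : V} (h : H.Adj a b) {i : ℕ} (h0 : 0 < i)
    (hi : i < (S.path h).length) {y : W} (hy : G.Adj ((S.path h).getVert i) y) :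
    y = (S.path h).getVert (i - 1) ∨ y = (S.path h).getVert (i + 1) := by
  obtain ⟨a', b', h', he⟩ := S.edge_cover _ _ hy
  obtain ⟨k, hk, hk'⟩ := (S.path h').mk_mem_edges_iff_exists.1 he
  rcases Sym2.eq_iff.1 hk' with ⟨e1, e2⟩ | ⟨e1, e2⟩
  · rcases eq_or_eq_reverse S h h' h0 hi hk.le e1.symm with ⟨rfl, rfl, rfl⟩ | ⟨rfl, rfl, e⟩
    · exact Or.inr e2.symm
    · left
      have hr : S.path h' = (S.path h).reverse := S.path_symm h
      rw [← e2, hr, Walk.getVert_reverse]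
      congr 1
      omega
  · rcases eq_or_eq_reverse S h h' h0 hi hk e2.symm with ⟨rfl, rfl, rfl⟩ | ⟨rfl, rfl, e⟩
    · exact Or.inl e1.symm
    · right
      have hr : S.path h' = (S.path h).reverse := S.path_symm h
      rw [← e1, hr, Walk.getVert_reverse]
      congr 1
      omega

theorem adj_branch {v : V} {y : W} (hy : G.Adj (S.branch v) y) :
    ∃ (b : V) (h : H.Adj v b), y = (S.path h).getVert 1 := by
  obtain ⟨a, b, h, he⟩ := S.edge_cover _ _ hy
  obtain ⟨k, hk, hk'⟩ := (S.path h).mk_mem_edges_iff_exists.1 he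
  rcases Sym2.eq_iff.1 hk' with ⟨e1, e2⟩ | ⟨e1, e2⟩
  · have hk0 : k = 0 := by
      by_contra h0
      exact getVert_notMem_range S h (Nat.pos_of_ne_zero h0) hk ⟨v, e1.symm⟩
    subst hk0
    obtain rfl : a = v := S.branch.injective ((S.path h).getVert_zero.symm.trans e1)
    exact ⟨b, h, e2.symm⟩
  · have hkl : k + 1 = (S.path h).length := by
      by_contra h0
      exact getVert_notMem_range S h (Nat.succ_pos k) (by omega) ⟨v, e2.symm⟩
    rw [hkl, Walk.getVert_length] at e2
    obtain rfl : b = v := S.branch.injective e2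
    refine ⟨a, h.symm, ?_⟩
    rw [S.path_symm h, Walk.getVert_reverse, ← e1]
    congr 1
    omega

theorem exists_eq_getVert {x : W} (hx : x ∉ Set.range S.branch) :
    ∃ (a b : V) (h : H.Adj a b) (i : ℕ), 0 < i ∧ i < (S.path h).length ∧
      (S.path h).getVert i = x := by
  obtain ⟨a, b, h, hs⟩ := (S.vertex_cover x).resolve_left hx
  obtain ⟨i, rfl, hi⟩ := Walk.mem_support_iff_exists_getVert.1 hs
  refine ⟨a, b, h, i, Nat.pos_of_ne_zero fun e => hx ?_, lt_of_le_of_ne hi fun e => hx ?_, rfl⟩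
  · rw [e, Walk.getVert_zero]; exact ⟨a, rfl⟩
  · rw [e, Walk.getVert_length]; exact ⟨b, rfl⟩

/-- A path leaving a branch vertex follows one of the paths of the subdivision. -/
theorem IsPathSeq.exists_eq_getVert {q : ℕ → W} {n : ℕ} (hq : IsPathSeq G q (n + 1)) (hn : 0 < n)
    {v : V} (hv : q 0 = S.branch v) :
    ∃ (b : V) (h : H.Adj v b), ∀ i ≤ n, i ≤ (S.path h).length → q i = (S.path h).getVert i := by
  obtain ⟨b, h, h1⟩ := adj_branch S (hv ▸ hq.1 0 (by omega))
  refine ⟨b, h, fun i => ?_⟩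
  induction i using Nat.strong_induction_on with
  | _ i ih =>
    intro hi hil
    match i, ih, hi, hil with
    | 0, _, _, _ => rw [hv, Walk.getVert_zero]
    | 1, _, _, _ => exact h1
    | i + 2, ih, hi, hil =>
      have e0 := ih i (by omega) (by omega) (by omega)
      have e1 := ih (i + 1) (by omega) (by omega) (by omega)
      have hadj := hq.1 (i + 1) (by omega)
      rw [e1] at hadj
      rcases adj_getVert S h (Nat.succ_pos i) (by omega) hadj with e | e
      · rw [show i.succ - 1 = i from rfl, ← e0] at e
        have := hq.2 _ (by omega) _ (by omega) e
        omega
      · exact e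

/-- `u` is among the first `ρ v` vertices after `v` on a path of the subdivision leaving `v`. -/
def InBall (ρ : V → ℕ) (v : V) (u : W) : Prop :=
  ∃ (b : V) (h : H.Adj v b) (i : ℕ), 0 < i ∧ i ≤ ρ v ∧ (S.path h).getVert i = u

variable {S} {ρ : V → ℕ}

theorem InBall.unique (hρ : ∀ (a b : V) (h : H.Adj a b), ρ a + ρ b < (S.path h).length)
    {v v' : V} {u : W} (hv : InBall S ρ v u) (hv' : InBall S ρ v' u) : v = v' := by
  obtain ⟨b, h, i, h0, hi, rfl⟩ := hv
  obtain ⟨b', h', i', h0', hi', e⟩ := hv'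
  have h1 := hρ _ _ h
  have h2 := hρ _ _ h'
  rcases eq_or_eq_reverse S h h' h0 (by omega) (by omega) e.symm with
    ⟨rfl, -, -⟩ | ⟨rfl, rfl, e⟩
  · rfl
  · omega

theorem InBall.notMem_range (hρ : ∀ (a b : V) (h : H.Adj a b), ρ a + ρ b < (S.path h).length)
    {v : V} {u : W} (hv : InBall S ρ v u) : u ∉ Set.range S.branch := by
  obtain ⟨b, h, i, h0, hi, rfl⟩ := hv
  exact getVert_notMem_range S h h0 (by have := hρ _ _ h; omega)

end Subdivision

section Lists

variable {V : Type*} {W : Type*} {C : Type*} {H : SimpleGraph V} {G : SimpleGraph W}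

/-- The lists left when the branch vertices are precoloured by `c₀` and the colour of each branch
vertex `v` is forbidden within distance `ρ v`. -/
noncomputable def reducedList (S : H.Subdivision G) (ρ : V → ℕ) (c₀ : V → C) (L : W → Finset C)
    (x : W) : Finset C :=
  (L x).filter fun a => (∀ v, S.branch v = x → a = c₀ v) ∧ ∀ v, InBall S ρ v x → a ≠ c₀ v

theorem mem_reducedList {S : H.Subdivision G} {ρ : V → ℕ} {c₀ : V → C} {L : W → Finset C}
    {x : W} {a : C} : a ∈ reducedList S ρ c₀ L x ↔
      a ∈ L x ∧ (∀ v, S.branch v = x → a = c₀ v) ∧ ∀ v, InBall S ρ v x → a ≠ c₀ v := by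
  rw [reducedList, Finset.mem_filter]

theorem card_neighborFinset_branch_le [Fintype V] [Fintype W] (S : H.Subdivision G) (v : V) :
    (G.neighborFinset (S.branch v)).card ≤ (H.neighborFinset v).card := by
  refine (Finset.card_le_card ?_).trans (Finset.card_image_le (s := H.neighborFinset v)
    (f := fun b => if h : H.Adj v b then (S.path h).getVert 1 else S.branch v))
  intro y hy
  obtain ⟨b, h, rfl⟩ := adj_branch S ((G.mem_neighborFinset _ _).1 hy)
  exact Finset.mem_image.2 ⟨b, (H.mem_neighborFinset _ _).2 h, dif_pos h⟩

theorem isSparse_reducedList [Fintype V] [Fintype W] (S : H.Subdivision G) {ρ : V → ℕ}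
    (hρ : ∀ (a b : V) (h : H.Adj a b), ρ a + ρ b < (S.path h).length)
    (hρ' : ∀ a b : V, H.Adj a b → 1000 ≤ ρ a)
    (hdeg : ∀ v, 2 * ((H.neighborFinset v).card + 1 : ℝ) ≤ (1001 / 1000) ^ max 1000 (ρ v))
    {L : W → Finset C} (hL : ∀ x, (L x).card = 5) {c₀ : V → C} (hc₀ : ∀ v, c₀ v ∈ L (S.branch v)) :
    IsSparse G (univ.map S.branch) (reducedList S ρ c₀ L)
      (Function.extend S.branch (fun v => max 1000 (ρ v)) 0) := by
  have hB : ∀ x, x ∈ univ.map S.branch ↔ x ∈ Set.range S.branch := by simp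
  have hext : ∀ v, Function.extend S.branch (fun v => max 1000 (ρ v)) 0 (S.branch v) =
      max 1000 (ρ v) := fun v => S.branch.injective.extend_apply _ _ _
  have hfour : ∀ x ∉ univ.map S.branch, 4 ≤ (reducedList S ρ c₀ L x).card := by
    intro x hx
    rw [hB] at hx
    by_cases hv : ∃ v, InBall S ρ v x
    · obtain ⟨v, hv⟩ := hv
      have hsub : (L x).erase (c₀ v) ⊆ reducedList S ρ c₀ L x := by
        intro a ha
        rw [Finset.mem_erase] at ha
        refine mem_reducedList.2 ⟨ha.2, fun w hw => absurd ⟨w, hw⟩ hx, fun w hw => ?_⟩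
        rw [← hv.unique hρ hw]
        exact ha.1
      have h1 := Finset.card_le_card hsub
      have h2 := Finset.pred_card_le_card_erase (s := L x) (a := c₀ v)
      rw [hL] at h2
      omega
    · have hsub : L x ⊆ reducedList S ρ c₀ L x := fun a ha =>
        mem_reducedList.2 ⟨ha, fun w hw => absurd ⟨w, hw⟩ hx, fun w hw => absurd ⟨w, hw⟩ hv⟩
      have h1 := Finset.card_le_card hsub
      rw [hL] at h1
      omega
  refine ⟨?_, ?_, hfour, ?_, ?_, ?_, ?_⟩
  · intro x hx y₁ y₂ y₃ h₁ h₂ h₃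
    rw [hB] at hx
    obtain ⟨a, b, h, i, h0, hi, rfl⟩ := exists_eq_getVert S hx
    rcases adj_getVert S h h0 hi h₁ with e₁ | e₁ <;> rcases adj_getVert S h h0 hi h₂ with e₂ | e₂ <;>
      rcases adj_getVert S h h0 hi h₃ with e₃ | e₃ <;> simp [e₁, e₂, e₃]
  · rintro T ⟨x, hx⟩ hT
    have hTB : ∀ y ∈ T, y ∉ Set.range S.branch := fun y hy => (hB y).not.1 (hT y hy)
    obtain ⟨a, b, h, i, h0, hi, rfl⟩ := exists_eq_getVert S (hTB x hx)
    -- the first vertex of `T` on the path has no neighbour in `T` before it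
    have hex : ∃ i, (S.path h).getVert i ∈ T := ⟨i, hx⟩
    have hle := Nat.find_min' hex hx
    have hmem := Nat.find_spec hex
    have hmin := fun m => Nat.find_min hex (m := m)
    set k := Nat.find hex
    have hk0 : 0 < k := by
      refine Nat.pos_of_ne_zero fun e => ?_
      rw [e, Walk.getVert_zero] at hmem
      exact hTB _ hmem ⟨a, rfl⟩
    have hnext : ∀ y ∈ T, G.Adj ((S.path h).getVert k) y → y = (S.path h).getVert (k + 1) := by
      intro y hy hadj
      rcases adj_getVert S h hk0 (by omega) hadj with e | e
      · exact absurd (e ▸ hy) (hmin (k - 1) (by omega))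
      · exact e
    exact ⟨_, hmem, fun y hy z hz h1 h2 => (hnext y hy h1).trans (hnext z hz h2).symm⟩
  · intro x
    by_cases hx : x ∈ univ.map S.branch
    · obtain ⟨v, rfl⟩ := (hB x).1 hx
      refine ⟨c₀ v, mem_reducedList.2 ⟨hc₀ v, fun w hw => ?_, fun w hw => ?_⟩⟩
      · rw [S.branch.injective hw]
      · exact absurd ⟨v, rfl⟩ (hw.notMem_range hρ)
    · exact Finset.card_pos.1 (lt_of_lt_of_le (by norm_num) (hfour x hx))
  · intro b hb
    obtain ⟨v, rfl⟩ := (hB b).1 hb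
    rw [hext]
    exact le_trans (by norm_num) (le_max_left _ _)
  · intro b hb
    obtain ⟨v, rfl⟩ := (hB b).1 hb
    rw [hext]
    refine le_trans ?_ (hdeg v)
    have : ((G.neighborFinset (S.branch v)).card : ℝ) ≤ (H.neighborFinset v).card := by
      exact_mod_cast card_neighborFinset_branch_le S v
    linarith
  · intro p n hp hb hn i h0 hi
    obtain ⟨v, hv⟩ := (hB _).1 hb
    obtain ⟨b, h, hpath⟩ := hp.exists_eq_getVert S (by omega) hv.symm
    rw [← hv, hext, max_eq_right (hρ' v b h)] at hn
    have hlen := hρ v b h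
    have hball : InBall S ρ v (p i) := ⟨b, h, i, h0, by omega, (hpath i hi (by omega)).symm⟩
    refine ⟨fun hpi => hball.notMem_range hρ ((hB _).1 hpi), ?_⟩
    rw [Finset.disjoint_left]
    intro a ha ha'
    exact (mem_reducedList.1 ha').2.2 v hball ((mem_reducedList.1 ha).2.1 v hv)

end Lists

/-- The radius absorbs the degree: `(1 + 1 / 1000) ^ 1000 ≥ 2` by Bernoulli's inequality. The
degree `D = 0`, where the logarithm vanishes, is covered by `1000 ≤ n`. -/
theorem two_mul_le_pow {D : ℝ} {n : ℕ} (hD : D = 0 ∨ 1 ≤ D) (hn : 1000 ≤ n)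
    (h : (10 : ℝ) ^ 5 * Real.logb 2 (D + 1) ≤ n) : 2 * (D + 1) ≤ (1001 / 1000 : ℝ) ^ n := by
  have hn' : (1000 : ℝ) ≤ n := by exact_mod_cast hn
  have hD1 : 0 < D + 1 := by rcases hD with h | h <;> linarith
  have hbern : (2 : ℝ) ≤ (1001 / 1000) ^ 1000 := by
    have := one_add_mul_le_pow (show (-2 : ℝ) ≤ 1 / 1000 by norm_num) 1000
    calc (2 : ℝ) = 1 + (1000 : ℕ) * (1 / 1000) := by norm_num
      _ ≤ (1 + 1 / 1000) ^ 1000 := this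
      _ = (1001 / 1000) ^ 1000 := by rw [show (1 + 1 / 1000 : ℝ) = 1001 / 1000 by norm_num]
  have hlog : 1 + Real.logb 2 (D + 1) ≤ (n : ℝ) / 1000 := by
    rw [le_div_iff₀ (by norm_num)]
    rcases hD with rfl | hD
    · simpa using hn'
    · have : 1 ≤ Real.logb 2 (D + 1) := by
        rw [Real.le_logb_iff_rpow_le (by norm_num) hD1, Real.rpow_one]
        linarith
      norm_num at h
      linarith
  calc 2 * (D + 1) = (2 : ℝ) ^ (1 + Real.logb 2 (D + 1)) := by
        rw [Real.rpow_add (by norm_num), Real.rpow_one,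
          Real.rpow_logb (by norm_num) (by norm_num) hD1]
    _ ≤ (2 : ℝ) ^ ((n : ℝ) / 1000) := Real.rpow_le_rpow_of_exponent_le (by norm_num) hlog
    _ ≤ ((1001 / 1000 : ℝ) ^ 1000) ^ ((n : ℝ) / 1000) :=
        Real.rpow_le_rpow (by norm_num) hbern (by positivity)
    _ = (1001 / 1000 : ℝ) ^ n := by
        rw [← Real.rpow_natCast, ← Real.rpow_mul (by norm_num), Nat.cast_ofNat,
          mul_div_cancel₀ _ (by norm_num), Real.rpow_natCast]

end NonrepSubdivision

theorem mainTheorem2 {V : Type u} {W : Type v} [Fintype V] [Finite W]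
    (H : SimpleGraph V) [DecidableRel H.Adj] (G : SimpleGraph W) (S : H.Subdivision G)
    (hS : ∀ (a b : V) (h : H.Adj a b),
      ⌈(10 : ℝ) ^ 5 * Real.logb 2 ((H.degree a : ℝ) + 1)⌉₊ +
        ⌈(10 : ℝ) ^ 5 * Real.logb 2 ((H.degree b : ℝ) + 1)⌉₊ + 2 ≤ S.numDivisionVertices h) :
    SimpleGraph.IsNonrepetitivelyChoosable.{v, w} G 5 := by
  classical
  intro C L hL
  have := Fintype.ofFinite W
  have hsub : ∀ x, ∃ F : Finset C, ↑F ⊆ L x ∧ F.card = 5 := by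
    intro x
    obtain ⟨t, ht, hc⟩ := Set.exists_subset_encard_eq (hL x)
    have hfin : t.Finite := Set.finite_of_encard_eq_coe hc
    refine ⟨hfin.toFinset, by simpa using ht, ?_⟩
    rw [hfin.encard_eq_coe_toFinset_card] at hc
    exact_mod_cast hc
  choose F hFL hF using hsub
  have hne : ∀ v, ∃ a, a ∈ F (S.branch v) := fun v =>
    Finset.card_pos.1 (by rw [hF]; norm_num)
  choose c₀ hc₀ using hne
  set ρ : V → ℕ := fun v => ⌈(10 : ℝ) ^ 5 * Real.logb 2 ((H.degree v : ℝ) + 1)⌉₊ with hρ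
  have hρ1 : ∀ (a b : V) (h : H.Adj a b), ρ a + ρ b < (S.path h).length := by
    intro a b h
    have h1 := hS a b h
    unfold SimpleGraph.Subdivision.numDivisionVertices at h1
    simp only [hρ]
    omega
  have hρ2 : ∀ a b : V, H.Adj a b → 1000 ≤ ρ a := by
    intro a b h
    have hpos : 0 < H.degree a := (H.degree_pos_iff_exists_adj a).2 ⟨b, h⟩
    have hd : (1 : ℝ) ≤ H.degree a := by exact_mod_cast hpos
    have hl : 1 ≤ Real.logb 2 ((H.degree a : ℝ) + 1) := by
      rw [Real.le_logb_iff_rpow_le (by norm_num) (by linarith), Real.rpow_one]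
      linarith
    have : ((1000 : ℕ) : ℝ) ≤ ρ a := by
      refine le_trans ?_ (Nat.le_ceil _)
      norm_num
      linarith
    exact_mod_cast this
  have hρ3 : ∀ v, 2 * ((H.neighborFinset v).card + 1 : ℝ) ≤ (1001 / 1000) ^ max 1000 (ρ v) := by
    intro v
    refine NonrepSubdivision.two_mul_le_pow ?_ (le_max_left _ _) ?_
    · rcases Nat.eq_zero_or_pos (H.neighborFinset v).card with h | h
      · exact Or.inl (by exact_mod_cast h)
      · exact Or.inr (by exact_mod_cast h)
    · exact (Nat.le_ceil _).trans (Nat.cast_le.2 (le_max_right 1000 (ρ v)))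
  have hsparse := NonrepSubdivision.isSparse_reducedList S hρ1 hρ2
    (fun v => by convert hρ3 v) hF hc₀
  obtain ⟨c, hc, hrep⟩ := hsparse.exists_isNonrepetitive
  exact ⟨c, fun x => hFL x (NonrepSubdivision.mem_reducedList.1 (hc x)).1, hrep⟩
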